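/- **Setting.** A *grid graph* is a finite undirected graph $G=(V,E)$ with $V\subset\mathbb Z^2$ whose edges join points that are adjacent horizontally, vertically or diagonally; $n_v=|V|$, $n_e=|E|$. An instance of the (surrogate) *RCDP problem* consists of a grid graph, a finite set $X$ of obstacles $x$, each a closed disk $D(x)\subset\mathbb R^2$ of positive radius with a blockage probability $\pi_x\in[0,1]$, a disambiguation cost $\delta_x>0$ and a risk penalty $r_x\ge 0$ (given by any risk function), vertices $s,t\in V$ and a budget $\delta_{\max}\in\mathbb R$. For an edge $e$ let $X_e=\{x\in X: D(x)\cap e\ne\emptyset\}$, let $\ell_e$ be its Euclidean length, and put $$c_e=\ell_e+\tfrac12\sum_{x\in X_e}r_x,\qquad \delta_e=\tfrac12\sum_{x\in X_e}\delta_x .$$ For a path $p$ let $c_p=\sum_{e\in p}c_e$ and $\delta_p=\sum_{e\in p}\delta_e$ (with multiplicities for a walk). The problem is to minimize $c_p$ over the $s$–$t$ paths $p$ with $\delta_p\le\delta_{\max}$ (the *feasible* paths). Its Lagrangian dual function is $\Phi(\mu)=\min_p\{c_p+\mu(\delta_p-\delta_{\max})\}$, $\mu\ge0$, the minimum being over all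 $s$–$t$ paths. **The COLOGR algorithm.** For edge lengths and a vertex $v$, "the best route through $v$" is a shortest $s$–$v$ path followed by a shortest $v$–$t$ path, computed by Dijkstra's algorithm (with a heap as priority queue) on the vertices not yet eliminated; if there is none, its values count as $+\infty$. "$\lambda=\infty$" means minimizing $\delta$, ties being broken by $c$. A route that is returned is first freed of closed detours. 1. Compute $p^\infty$ (least $\delta$) and $p^0$ (least $c$) from $s$ to $t$. If there is no $s$–$t$ path, report infeasibility. If $\delta_{p^0}\le\delta_{\max}$, return $p^0$ as optimal. If $\delta_{p^\infty}>\delta_{\max}$, report infeasibility. Put $p_U=p^\infty$. 2. (COGR) Scan the remaining vertices $v$, repeating the scan until one eliminates nothing: compute the best routes $p_v^\infty$ and $p_v^0$ through $v$; if $\delta_{p_v^\infty}>\delta_{\max}$ or $c_{p_v^0}>c_{p_U}$, eliminate $v$ at once with its incident edges; otherwise replace $p_U$ by $p_v^\infty$ if that is cheaper, then by $p_v^0$ if that is cheaper and feasible. 3. Recompute $p^\infty,p^0$ in the reduced graph; if $\delta_{p^0}\le\delta_{\max}$, return $p^0$ as optimal; otherwise put $p^-=p^\infty$, $p^+=p^0$.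 (If no $s$–$t$ path remained here or in step 4, $p_U$ would be returned as optimal.) 4. (LOGR) Repeat: let $\lambda=(c_{p^-}-c_{p^+})/(\delta_{p^+}-\delta_{p^-})$ and let $p$ be a shortest $s$–$t$ path for the lengths $c_e+\lambda\delta_e$. If $\delta_p=\delta_{\max}$, return $p$ as optimal. For each remaining vertex $v$ compute the best route $q$ through $v$ for these lengths; if $c_q<c_{p_U}$ and $\delta_q\le\delta_{\max}$, put $p_U=q$; else if $c_q+\lambda(\delta_q-\delta_{\max})>c_{p_U}$, eliminate $v$. Let $L$ be the least value $c_q+\lambda(\delta_q-\delta_{\max})$ over the vertices kept. If $L=c_{p_U}$, return $p_U$ as optimal. If $c_p+\lambda\delta_p$ equals the corresponding value of $p^+$ or $p^-$ (then $\lambda$ is an optimal multiplier), return $p_U$ as the best feasible path, with the bound $L$. Otherwise replace $p^-$ by $p$ if $\delta_p<\delta_{\max}$, and $p^+$ by $p$ if not. Time is counted on a real RAM in which an arithmetic operation or comparison of reals, an access to an array cell, and a pointer or list operation have unit cost. **Theorem.** On every instance the COLOGR algorithm terminates, and its output is correct: - if it reports infeasibility, there is no feasible path; - if it returns a path as optimal,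 this is a feasible $s$–$t$ path of least cost $c_p$; - if it returns a path as best feasible with the bound $L$, this is a feasible $s$–$t$ path, and $\Phi(\mu)\le L\le c_q$ for all $\mu\ge0$ and all feasible paths $q$. Moreover, there is an absolute constant $C>0$ such that on every instance with $n_e\ge2$ its number of steps is at most $$C\; n_v\, n_e^2\,\log n_e\,\bigl(n_e+n_v\log n_v\bigr).$$ -/

import Mathlib

/-! ## Timed computations

A value of `Comp α` is a possibly non-terminating computation that counts its steps.  The model is
the usual real RAM with unit costs: one step (`tick`) pays for a bounded number of elementary
operations, namely arithmetic operations and comparisons on real numbers, reading or writing one cell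
of an array (arrays indexed by vertices appear as functions), following a pointer, and consing onto or
matching on a list.  All work that is not bounded is done in loops and recursions that tick in each
round. -/

/-- Partial computations with a step count. -/
def Comp (α : Type) : Type := Part (α × ℕ)

namespace Comp

/-- `x.RunsTo a n`: the computation `x` halts with the result `a` after exactly `n` steps. -/
def RunsTo {α : Type} (x : Comp α) (a : α) (n : ℕ) : Prop :=
  (a, n) ∈ (show Part (α × ℕ) from x)

/-- The computation that returns `a` without any step. -/
def ret {α : Type} (a : α) : Comp α := Part.some (a, 0)

/-- Sequential composition; the step counts add up. -/
def andThen {α β : Type} (x : Comp α) (f : α → Comp β) : Comp β :=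
  Part.bind (show Part (α × ℕ) from x) fun p =>
    Part.map (fun q : β × ℕ => (q.1, p.2 + q.2)) (show Part (β × ℕ) from f p.1)

instance : Monad Comp where
  pure := ret
  bind := andThen

/-- One step. -/
def tick : Comp Unit := Part.some ((), 1)

/-- The unbounded loop: from the state `s` run `body s`; go on with `s'` if it returns `inl s'`, stop
with `b` if it returns `inr b`.  Each round costs one step on top of those of `body`.  A loop that is
never left does not halt. -/
noncomputable def loop {σ β : Type} (body : σ → Comp (σ ⊕ β)) (s : σ) : Comp β :=
  PFun.fix
    (fun st : σ × ℕ =>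
      Part.map
        (fun r : (σ ⊕ β) × ℕ =>
          match r.1 with
          | Sum.inl s' => (Sum.inr (s', st.2 + r.2 + 1) : (β × ℕ) ⊕ (σ × ℕ))
          | Sum.inr b => Sum.inl (b, st.2 + r.2 + 1))
        (show Part ((σ ⊕ β) × ℕ) from body st.1))
    (s, 0)

end Comp

open Comp

/-! ## Priority queues: leftist heaps -/

/-- A queue entry of Dijkstra's algorithm: a vertex, a tentative distance, and the predecessor through
which this distance is attained. -/
structure Entry (K V : Type) where
  key : K
  vert : V
  parent : Option V

/-- Binary trees whose nodes carry a rank (the length of the right spine) and an entry. -/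
inductive Heap (K V : Type) where
  | nil : Heap K V
  | node (rank : ℕ) (entry : Entry K V) (left right : Heap K V) : Heap K V

namespace Heap

variable {K V : Type}

/-- The stored rank. -/
def rank : Heap K V → ℕ
  | nil => 0
  | node r _ _ _ => r

/-- The number of entries (used only to see that `merge` terminates). -/
def size : Heap K V → ℕ
  | nil => 0
  | node _ _ l r => l.size + r.size + 1

/-- A node in which the subtree of smaller rank is put on the right. -/
def mkNode (e : Entry K V) (a b : Heap K V) : Heap K V :=
  if b.rank ≤ a.rank then node (b.rank + 1) e a b else node (a.rank + 1) e b a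

/-- The heap with one entry. -/
def single (e : Entry K V) : Heap K V := node 1 e nil nil

/-- Merging of two leftist heaps along their right spines. -/
def merge [LinearOrder K] : Heap K V → Heap K V → Comp (Heap K V)
  | nil, h => do
      tick
      pure h
  | node ra a la ra', nil => do
      tick
      pure (node ra a la ra')
  | node ra a la ra', node rb b lb rb' => do
      tick
      if a.key ≤ b.key then
        let h ← merge ra' (node rb b lb rb')
        pure (mkNode a la h)
      else
        let h ← merge (node ra a la ra') rb'
        pure (mkNode b lb h)
termination_by h h' => h.size + h'.size
decreasing_by
  all_goals simp only [size]; omega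

end Heap

/-! ## Networks and Dijkstra's algorithm -/

/-- The input of the algorithm: a graph, given by a list of its vertices and by adjacency lists, with
a cost and a weight for each edge, a source, a target, and a budget for the total weight. -/
structure Network (V : Type) where
  verts : List V
  nbrs : V → List V
  cost : V → V → ℝ
  weight : V → V → ℝ
  src : V
  dst : V
  budget : ℝ

/-- The tables of Dijkstra's algorithm: the distance (if the vertex is settled) and the predecessor. -/
structure Tables (K V : Type) where
  dist : V → Option K
  parent : V → Option V

/-- A route from source to target: its list of vertices, with its total cost and total weight. -/
structure Route (V : Type) where
  verts : List V
  cost : ℝ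
  weight : ℝ

/-- What the algorithm reports: that there is no path within the budget; or a path which it returns as
optimal; or the best feasible path found, together with the final lower bound. -/
inductive Outcome (V : Type) where
  | infeasible : Outcome V
  | optimal (path : List V) : Outcome V
  | bestFeasible (path : List V) (lower : ℝ) : Outcome V

/-- The state of the first phase during a scan: the vertices still present, the incumbent `p_U`, and
whether a vertex was eliminated in this scan. -/
structure CogrState (V : Type) where
  alive : V → Bool
  best : Route V
  changed : Bool

/-- The state of the second phase during a scan: the vertices still present, the incumbent `p_U`, and
the least dual value of a vertex kept so far. -/
structure ScanState (V : Type) where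
  alive : V → Bool
  best : Route V
  lower : ℝ

/-- The state of the second phase between two multipliers: the vertices still present, the incumbent
`p_U`, the path `p⁺` above the budget, and the path `p⁻` that respects it. -/
structure LogrState (V : Type) where
  alive : V → Bool
  best : Route V
  plus : Route V
  minus : Route V

section Procedures

variable {V : Type} [DecidableEq V]

namespace Network

/-- Relaxation of the edges at a newly settled entry `x`: every present and unsettled neighbour is
put into the queue.  The edges that are present are those both of whose ends are `alive`. -/
def relax {K : Type} [Add K] [LinearOrder K] (N : Network V) (alive : V → Bool) (len : V → V → K)
    (T : Tables K V) (x : Entry K V) (h : Heap K V) : Comp (Heap K V) :=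
  (N.nbrs x.vert).foldlM
    (fun h w => do
      tick
      if alive w && (T.dist w).isNone then
        h.merge (Heap.single ⟨x.key + len x.vert w, w, some x.vert⟩)
      else
        pure h)
    h

/-- Dijkstra's algorithm from `v` for the edge lengths `len`, on the graph induced by `alive`. -/
noncomputable def dijkstra {K : Type} [Zero K] [Add K] [LinearOrder K] (N : Network V)
    (alive : V → Bool) (len : V → V → K) (v : V) : Comp (Tables K V) := do
  -- the initialization of the tables
  N.verts.forM (fun _ => tick)
  loop
    (fun st : Heap K V × Tables K V =>
      match st with
      | (Heap.nil, T) => pure (Sum.inr T)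
      | (Heap.node _ x l r, T) => do
          let h ← l.merge r
          if (T.dist x.vert).isSome then
            pure (Sum.inl (h, T))
          else
            let T' : Tables K V :=
              { dist := Function.update T.dist x.vert (some x.key)
                parent := Function.update T.parent x.vert x.parent }
            let h' ← N.relax alive len T' x h
            pure (Sum.inl (h', T')))
    (Heap.single ⟨0, v, none⟩, { dist := fun _ => none, parent := fun _ => none })

/-- Reads a shortest path from the root of the tables to `w` off the predecessors, as the list of its
vertices; the result is `none` if `w` was not reached. -/
noncomputable def pathTo {K : Type} (T : Tables K V) (w : V) : Comp (Option (List V)) :=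
  match T.dist w with
  | none => do
      tick
      pure none
  | some _ => do
      let l ← loop
        (fun st : V × List V =>
          match T.parent st.1 with
          | none => pure (Sum.inr (st.1 :: st.2))
          | some u => pure (Sum.inl (u, st.1 :: st.2)))
        (w, [])
      pure (some l)

/-- `reverseOnto a b` is the reversal of `a`, followed by `b`. -/
def reverseOnto : List V → List V → Comp (List V)
  | [], b => do
      tick
      pure b
  | x :: a, b => do
      tick
      reverseOnto a (x :: b)

/-- The total cost and the total weight along a list of vertices. -/
noncomputable def measure (N : Network V) : List V → Comp (ℝ × ℝ)
  | u :: v :: l => do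
      tick
      let m ← N.measure (v :: l)
      pure (N.cost u v + m.1, N.weight u v + m.2)
  | _ => do
      tick
      pure (0, 0)

/-- The best route through `v` for the lengths `len` on the graph induced by `alive`: a shortest path
from the source to `v`, followed by a shortest path from `v` to the target.  Both come from one run of
Dijkstra's algorithm from `v`, as the graph is undirected.  For `v` the source this is a shortest path
from source to target. -/
noncomputable def routeThrough {K : Type} [Zero K] [Add K] [LinearOrder K] (N : Network V)
    (alive : V → Bool) (len : V → V → K) (v : V) : Comp (Option (Route V)) := do
  let T ← N.dijkstra alive len v
  let a ← pathTo T N.src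
  let b ← pathTo T N.dst
  match a, b with
  | some a, some b => do
      let l ← reverseOnto a b.tail
      let m ← N.measure l
      pure (some ⟨l, m.1, m.2⟩)
  | _, _ => pure none

/-- The suffix of a list that starts at the first occurrence of `x`. -/
def suffixFrom (x : V) : List V → Comp (Option (List V))
  | [] => do
      tick
      pure none
  | y :: l => do
      tick
      if x = y then pure (some (y :: l)) else suffixFrom x l

/-- Cuts the closed detours out of a route; what is left is a path, which repeats no vertex. -/
def eraseLoops : List V → Comp (List V)
  | [] => do
      tick
      pure []
  | x :: l => do
      tick
      let l' ← eraseLoops l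
      match ← suffixFrom x l' with
      | some l'' => pure l''
      | none => pure (x :: l')

/-- Lengths for the multiplier `λ = ∞`: the weight decides, and among equal weights the cost. -/
noncomputable def lenInf (N : Network V) (u v : V) : ℝ ×ₗ ℝ := toLex (N.weight u v, N.cost u v)

/-- Lengths for the multiplier `lam`: cost plus `lam` times weight. -/
noncomputable def lenAt (N : Network V) (lam : ℝ) (u v : V) : ℝ := N.cost u v + lam * N.weight u v

/-- The Lagrangian value of a route at the multiplier `lam`. -/
noncomputable def dualValue (N : Network V) (lam : ℝ) (p : Route V) : ℝ :=
  p.cost + lam * (p.weight - N.budget)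

/-! ### Phase 1: cost- and obstacle-based graph reduction (COGR) -/

/-- Treatment of one vertex in the first phase. -/
noncomputable def cogrVertex (N : Network V) (st : CogrState V) (v : V) : Comp (CogrState V) := do
  tick
  if st.alive v then
    let pInf ← N.routeThrough st.alive N.lenInf v
    let pZero ← N.routeThrough st.alive N.cost v
    match pInf, pZero with
    | some a, some b =>
        if N.budget < a.weight ∨ st.best.cost < b.cost then
          pure ⟨Function.update st.alive v false, st.best, true⟩
        else
          let U := if a.cost < st.best.cost then a else st.best
          let U' := if b.cost < U.cost ∧ b.weight ≤ N.budget then b else U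
          pure ⟨st.alive, U', st.changed⟩
    | _, _ => pure ⟨Function.update st.alive v false, st.best, true⟩
  else
    pure st

/-- The first phase: scan all vertices, until a scan eliminates none. -/
noncomputable def cogr (N : Network V) (alive : V → Bool) (best : Route V) :
    Comp ((V → Bool) × Route V) :=
  loop
    (fun st : (V → Bool) × Route V => do
      let r ← N.verts.foldlM N.cogrVertex ⟨st.1, st.2, false⟩
      if r.changed then pure (Sum.inl (r.alive, r.best)) else pure (Sum.inr (r.alive, r.best)))
    (alive, best)

/-! ### Phase 2: Lagrangian optimization with graph reduction (LOGR) -/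

/-- Treatment of one vertex in the second phase, at the multiplier `lam`. -/
noncomputable def logrVertex (N : Network V) (lam : ℝ) (st : ScanState V) (v : V) :
    Comp (ScanState V) := do
  tick
  if st.alive v then
    match ← N.routeThrough st.alive (N.lenAt lam) v with
    | some q =>
        if q.cost < st.best.cost ∧ q.weight ≤ N.budget then
          pure ⟨st.alive, q, min st.lower (N.dualValue lam q)⟩
        else if st.best.cost < N.dualValue lam q then
          pure ⟨Function.update st.alive v false, st.best, st.lower⟩
        else
          pure ⟨st.alive, st.best, min st.lower (N.dualValue lam q)⟩
    | none => pure ⟨Function.update st.alive v false, st.best, st.lower⟩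
  else
    pure st

/-- One round of the second phase. -/
noncomputable def logrStep (N : Network V) (st : LogrState V) :
    Comp (LogrState V ⊕ Outcome V) := do
  let lam := (st.minus.cost - st.plus.cost) / (st.plus.weight - st.minus.weight)
  match ← N.routeThrough st.alive (N.lenAt lam) N.src with
  | none => do
      let l ← eraseLoops st.best.verts
      pure (Sum.inr (Outcome.optimal l))
  | some p =>
      if p.weight = N.budget then do
        let l ← eraseLoops p.verts
        pure (Sum.inr (Outcome.optimal l))
      else do
        let r ← N.verts.foldlM (N.logrVertex lam) ⟨st.alive, st.best, N.dualValue lam p⟩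
        if r.lower = r.best.cost then do
          let l ← eraseLoops r.best.verts
          pure (Sum.inr (Outcome.optimal l))
        else if p.cost + lam * p.weight = st.plus.cost + lam * st.plus.weight ∨
            p.cost + lam * p.weight = st.minus.cost + lam * st.minus.weight then do
          let l ← eraseLoops r.best.verts
          pure (Sum.inr (Outcome.bestFeasible l r.lower))
        else if p.weight < N.budget then
          pure (Sum.inl ⟨r.alive, r.best, st.plus, p⟩)
        else
          pure (Sum.inl ⟨r.alive, r.best, p, st.minus⟩)

/-- The second phase. -/
noncomputable def logr (N : Network V) (st : LogrState V) : Comp (Outcome V) :=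
  loop N.logrStep st

/-! ### The whole algorithm -/

/-- The COLOGR algorithm. -/
noncomputable def cologr (N : Network V) : Comp (Outcome V) := do
  let pInf ← N.routeThrough (fun _ => true) N.lenInf N.src
  let pZero ← N.routeThrough (fun _ => true) N.cost N.src
  match pInf, pZero with
  | some a, some b =>
      if b.weight ≤ N.budget then do
        let l ← eraseLoops b.verts
        pure (Outcome.optimal l)
      else if N.budget < a.weight then
        pure Outcome.infeasible
      else do
        let red ← N.cogr (fun _ => true) a
        let pInf' ← N.routeThrough red.1 N.lenInf N.src
        let pZero' ← N.routeThrough red.1 N.cost N.src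
        match pInf', pZero' with
        | some a', some b' =>
            if b'.weight ≤ N.budget then do
              let l ← eraseLoops b'.verts
              pure (Outcome.optimal l)
            else
              N.logr ⟨red.1, red.2, b', a'⟩
        | _, _ => do
            let l ← eraseLoops red.2.verts
            pure (Outcome.optimal l)
  | _, _ => pure Outcome.infeasible

end Network

end Procedures

/-! ## The RCDP problem on a grid graph -/

/-- A disk-shaped obstacle: centre, radius, probability `π_x` of being blocking as reported by the
sensor, and disambiguation cost `δ_x`. -/
structure Obstacle where
  center : EuclideanSpace ℝ (Fin 2)
  radius : ℝ
  prob : ℝ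
  disambCost : ℝ

/-- Adjacency on the integer lattice: horizontal, vertical, or diagonal. -/
def LatticeAdj (u v : ℤ × ℤ) : Prop :=
  u ≠ v ∧ |u.1 - v.1| ≤ 1 ∧ |u.2 - v.2| ≤ 1

/-- A lattice point as a point of the Euclidean plane. -/
noncomputable def planePoint (v : ℤ × ℤ) : EuclideanSpace ℝ (Fin 2) := !₂[(v.1 : ℝ), (v.2 : ℝ)]

/-- An instance of the RCDP problem: a finite grid graph (a graph on finitely many points of the
integer lattice whose edges join points adjacent in the 8-adjacency), finitely many disk-shaped
obstacles, a risk function that gives a penalty `r_x ≥ 0` for each obstacle, a source, a target, and a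
disambiguation budget `δ_max`. -/
structure RCDPInstance where
  verts : List (ℤ × ℤ)
  verts_nodup : verts.Nodup
  graph : SimpleGraph (ℤ × ℤ)
  adj_mem : ∀ u v, graph.Adj u v → u ∈ verts ∧ v ∈ verts
  adj_lattice : ∀ u v, graph.Adj u v → LatticeAdj u v
  obstacles : Finset Obstacle
  radius_pos : ∀ x ∈ obstacles, 0 < x.radius
  prob_mem : ∀ x ∈ obstacles, x.prob ∈ Set.Icc (0 : ℝ) 1
  disambCost_pos : ∀ x ∈ obstacles, 0 < x.disambCost
  risk : Obstacle → ℝ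
  risk_nonneg : ∀ x ∈ obstacles, 0 ≤ risk x
  source : ℤ × ℤ
  target : ℤ × ℤ
  source_mem : source ∈ verts
  target_mem : target ∈ verts
  budget : ℝ

namespace RCDPInstance

/-- The number of vertices. -/
def numVerts (I : RCDPInstance) : ℕ := I.verts.length

/-- The number of edges. -/
noncomputable def numEdges (I : RCDPInstance) : ℕ := I.graph.edgeSet.ncard

open Classical in
/-- The set `X_e` of the obstacles whose closed disk meets the edge `e` between `u` and `v`. -/
noncomputable def obstaclesAt (I : RCDPInstance) (u v : ℤ × ℤ) : Finset Obstacle :=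
  I.obstacles.filter fun x =>
    (Metric.closedBall x.center x.radius ∩ segment ℝ (planePoint u) (planePoint v)).Nonempty

/-- The surrogate cost of an edge: its length plus half of the risk of the obstacles that it meets. -/
noncomputable def edgeCost (I : RCDPInstance) (u v : ℤ × ℤ) : ℝ :=
  dist (planePoint u) (planePoint v) + 1 / 2 * ∑ x ∈ I.obstaclesAt u v, I.risk x

/-- The disambiguation weight of an edge: half of the disambiguation costs of the obstacles that it
meets. -/
noncomputable def edgeWeight (I : RCDPInstance) (u v : ℤ × ℤ) : ℝ :=
  1 / 2 * ∑ x ∈ I.obstaclesAt u v, x.disambCost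

/-- The surrogate cost of a walk. -/
noncomputable def pathCost (I : RCDPInstance) {u v : ℤ × ℤ} (p : I.graph.Walk u v) : ℝ :=
  (p.darts.map fun d => I.edgeCost d.fst d.snd).sum

/-- The total disambiguation weight of a walk. -/
noncomputable def pathWeight (I : RCDPInstance) {u v : ℤ × ℤ} (p : I.graph.Walk u v) : ℝ :=
  (p.darts.map fun d => I.edgeWeight d.fst d.snd).sum

/-- A feasible solution: a path from the source to the target within the budget. -/
def Feasible (I : RCDPInstance) (p : I.graph.Walk I.source I.target) : Prop :=
  p.IsPath ∧ I.pathWeight p ≤ I.budget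

/-- An optimal solution: a feasible path of least surrogate cost. -/
def Optimal (I : RCDPInstance) (p : I.graph.Walk I.source I.target) : Prop :=
  I.Feasible p ∧ ∀ q : I.graph.Walk I.source I.target, I.Feasible q → I.pathCost p ≤ I.pathCost q

/-- What it means that an outcome of the algorithm is correct.  In the third case `lower` is a lower
bound for the optimal cost that is at least as good as every value of the Lagrangian dual function
`Φ(μ)`, the minimum over all paths `q` of `cost q + μ (weight q - budget)`, with `μ ≥ 0`. -/
def Solves (I : RCDPInstance) : Outcome (ℤ × ℤ) → Prop
  | Outcome.infeasible => ∀ q : I.graph.Walk I.source I.target, ¬ I.Feasible q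
  | Outcome.optimal path =>
      ∃ p : I.graph.Walk I.source I.target, p.support = path ∧ I.Optimal p
  | Outcome.bestFeasible path lower =>
      ∃ p : I.graph.Walk I.source I.target, p.support = path ∧ I.Feasible p ∧
        (∀ q : I.graph.Walk I.source I.target, I.Feasible q → lower ≤ I.pathCost q) ∧
        ∀ μ : ℝ, 0 ≤ μ → ∃ q : I.graph.Walk I.source I.target, q.IsPath ∧
          I.pathCost q + μ * (I.pathWeight q - I.budget) ≤ lower

open Classical in
/-- The adjacency lists, costs and weights that graph initialization hands to the algorithm. -/
noncomputable def toNetwork (I : RCDPInstance) : Network (ℤ × ℤ) where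
  verts := I.verts
  nbrs := fun v =>
    ([(1, 0), (1, 1), (0, 1), (-1, 1), (-1, 0), (-1, -1), (0, -1), (1, -1)].map
      fun d : ℤ × ℤ => v + d).filter fun w => I.graph.Adj v w
  cost := I.edgeCost
  weight := I.edgeWeight
  src := I.source
  dst := I.target
  budget := I.budget

end RCDPInstance

/-!
The algorithm is analysed on networks in which walks are lists of vertices; a small program logic,
`Comp.Ens`, proves results and step counts of the timed computations together.

*Correctness.* One fixed feasible walk of least cost is never touched by an elimination
(`KeepsOptimal`): a vertex is removed only if all walks through it violate the budget or have a
cost, or a Lagrangian value at some `λ ≥ 0`, above that of the incumbent, and by weak duality no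
vertex of an optimal walk is of this kind. The same comparison shows that the shortest route `p`
of a round of the second phase survives the scan of that round, and that the lower bound `L`
equals the Lagrangian value of `p`. Since the route found last is still present, the value of `p`
is at most the level at which the lines of `p⁺` and `p⁻` meet, and if it is not smaller, then `λ`
is optimal: the line of `p⁻` bounds the dual function for larger multipliers, that of `p⁺` for
smaller ones (`LogrInv.dual_le`).

*Number of multipliers.* While the second phase goes on, the meeting level decreases. Relative to
the final level, the new lines on either side of the budget form a sequence of Newton steps
(`NewtonSeq`) with slopes `g` and depths `d` that satisfy `d (j + 1) / d j + g (j + 1) / g j ≤ 1`.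
Slopes are values of one linear form on the zero-one vectors of the routes. If a linear form takes
values that decrease by factors of at least `M` on `q` such vectors, then the `M ^ q` combinations
of them with coefficients below `M` are distinct, as the digits of a number are, and they lie in a
small box (`pow_le_of_geometric`). Hence the slope can be halved `O(m log m)` times only. If the
slope is not halved in a window of many steps, then most of these steps hardly change it, so that
by the Newton inequality they divide the depth by more than the number of variables; the depths in
the window interlace with the values of one linear form, and by the same counting this happens
`O(m)` times only. Together there are `O(m² log m)` rounds (`NewtonSeq.length_lt`,
`Rounds.length_le`).

*Time.* With leftist heaps and degrees of at most eight, Dijkstra's algorithm takes time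
`O(n log n)` on `n` vertices (`ens_dijkstra`). The first scan of the first phase removes all vertices that
are not linked to source and target, and every later one but the last removes another vertex, so
that there are `O(m)` scans with `n` vertices each; a round of the second phase treats `n`
vertices as well.
-/

set_option linter.unusedSectionVars false

/-! ### A program logic for timed computations -/

namespace Comp

/-- Total correctness with time: the computation `x` halts, and its result and its number of steps
satisfy `P`. -/
def Ens {α : Type} (x : Comp α) (P : α → ℕ → Prop) : Prop :=
  ∃ a n, x.RunsTo a n ∧ P a n

variable {α β σ : Type}

theorem Ens.mono {x : Comp α} {P Q : α → ℕ → Prop} (h : x.Ens P) (hPQ : ∀ a n, P a n → Q a n) :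
    x.Ens Q := by
  obtain ⟨a, n, h1, h2⟩ := h
  exact ⟨a, n, h1, hPQ a n h2⟩

theorem ens_pure {a : α} {P : α → ℕ → Prop} (h : P a 0) : (pure a : Comp α).Ens P :=
  ⟨a, 0, Part.mem_some _, h⟩

theorem ens_bind {x : Comp α} {f : α → Comp β} {P : β → ℕ → Prop}
    (h : x.Ens fun a n => (f a).Ens fun b k => P b (n + k)) : (x >>= f).Ens P := by
  obtain ⟨a, n, h1, b, k, h2, h3⟩ := h
  exact ⟨b, n + k, Part.mem_bind h1 (Part.mem_map (fun q : β × ℕ => (q.1, n + q.2)) h2), h3⟩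

theorem ens_tick {P : Unit → ℕ → Prop} (h : P () 1) : tick.Ens P :=
  ⟨(), 1, Part.mem_some _, h⟩

theorem ens_tick_bind {f : Unit → Comp β} {P : β → ℕ → Prop}
    (h : (f ()).Ens fun b k => P b (1 + k)) : (tick >>= f).Ens P :=
  ens_bind (ens_tick h)

/-- One round of a loop, on states that carry the number of steps made so far. -/
noncomputable def loopStep (body : σ → Comp (σ ⊕ β)) : σ × ℕ →. (β × ℕ) ⊕ (σ × ℕ) := fun st =>
  Part.map
    (fun r : (σ ⊕ β) × ℕ =>
      match r.1 with
      | Sum.inl s' => (Sum.inr (s', st.2 + r.2 + 1) : (β × ℕ) ⊕ (σ × ℕ))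
      | Sum.inr b => Sum.inl (b, st.2 + r.2 + 1))
    (show Part ((σ ⊕ β) × ℕ) from body st.1)

theorem runsTo_loop {body : σ → Comp (σ ⊕ β)} {s : σ} {b : β} {n : ℕ}
    (h : (b, n) ∈ (loopStep body).fix (s, 0)) : (loop body s).RunsTo b n := by
  have e : (loop body s).RunsTo b n ↔ (b, n) ∈ (loopStep body).fix (s, 0) := by
    unfold RunsTo loop
    refine iff_of_eq (congrArg (fun f => (b, n) ∈ PFun.fix f (s, 0)) (funext fun st => ?_))
    refine congrArg (fun f => Part.map f _) (funext fun r => ?_)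
    rcases r with ⟨_ | _, _⟩ <;> rfl
  exact e.2 h

theorem inr_mem_loopStep {body : σ → Comp (σ ⊕ β)} {s s' : σ} {n : ℕ} (t : ℕ)
    (h : (body s).RunsTo (Sum.inl s') n) : Sum.inr (s', t + n + 1) ∈ loopStep body (s, t) :=
  (Part.mem_map_iff _).2 ⟨_, h, rfl⟩

theorem inl_mem_loopStep {body : σ → Comp (σ ⊕ β)} {s : σ} {b : β} {n : ℕ} (t : ℕ)
    (h : (body s).RunsTo (Sum.inr b) n) : Sum.inl (b, t + n + 1) ∈ loopStep body (s, t) :=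
  (Part.mem_map_iff _).2 ⟨_, h, rfl⟩

/-- The rule for unbounded loops.  The invariant may depend on a ghost value `g`, which records
information about the earlier rounds; the potential `φ` pays for the rounds that are still to come. -/
theorem ens_loop {γ : Type*} {body : σ → Comp (σ ⊕ β)} (Inv : γ → σ → Prop) (φ : γ → σ → ℕ)
    (Q : β → Prop)
    (h : ∀ g s, Inv g s → (body s).Ens fun r n =>
      (∃ s', r = Sum.inl s' ∧ ∃ g', Inv g' s' ∧ n + 1 + φ g' s' ≤ φ g s) ∨
      (∃ b, r = Sum.inr b ∧ Q b ∧ n + 1 ≤ φ g s))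
    {g : γ} {s : σ} (hs : Inv g s) : (loop body s).Ens fun b n => Q b ∧ n ≤ φ g s := by
  suffices H : ∀ m g s, Inv g s → φ g s ≤ m → ∀ t : ℕ,
      ∃ b n, (b, t + n) ∈ (loopStep body).fix (s, t) ∧ Q b ∧ n ≤ φ g s by
    obtain ⟨b, n, h1, h2⟩ := H _ g s hs le_rfl 0
    rw [Nat.zero_add] at h1
    exact ⟨b, n, runsTo_loop h1, h2⟩
  intro m
  induction m with
  | zero =>
    intro g s hs hm t
    obtain ⟨r, n, -, ⟨s', -, g', -, hle⟩ | ⟨b, -, -, hle⟩⟩ := h g s hs <;> omega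
  | succ m ih =>
    intro g s hs hm t
    obtain ⟨r, n, hr, ⟨s', rfl, g', hs', hle⟩ | ⟨b, rfl, hb, hle⟩⟩ := h g s hs
    · obtain ⟨b, k, h1, h2, h3⟩ := ih g' s' hs' (by omega) (t + n + 1)
      refine ⟨b, n + 1 + k, ?_, h2, by omega⟩
      rw [PFun.mem_fix_iff]
      refine Or.inr ⟨(s', t + n + 1), inr_mem_loopStep t hr, ?_⟩
      rwa [show t + (n + 1 + k) = t + n + 1 + k by omega]
    · exact ⟨b, n + 1, PFun.fix_stop (inl_mem_loopStep t hr), hb, hle⟩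

/-- The rule for a pass over a list, with an invariant that depends on the part of the list that is
still to be processed. -/
theorem ens_foldlM {f : σ → α → Comp σ} (I : List α → σ → Prop) (b : ℕ)
    (h : ∀ a l s, I (a :: l) s → (f s a).Ens fun s' n => n ≤ b ∧ I l s') :
    ∀ (l : List α) (s : σ), I l s →
      (l.foldlM f s).Ens fun s' n => n ≤ l.length * b ∧ I [] s'
  | [], s, hs => ens_pure ⟨by simp, hs⟩
  | a :: l, s, hs => by
    rw [List.foldlM_cons]
    refine ens_bind ((h a l s hs).mono fun s' n hn => ?_)
    refine (ens_foldlM I b h l s' hn.2).mono fun s'' k hk => ⟨?_, hk.2⟩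
    rw [List.length_cons, Nat.add_mul]
    omega

theorem ens_forM_tick (l : List α) :
    (l.forM fun _ => tick).Ens fun _ n => n = l.length := by
  induction l with
  | nil => exact ens_pure rfl
  | cons a l ih =>
    refine ens_tick_bind (f := fun _ => l.forM fun _ => tick) (ih.mono fun _ n hn => ?_)
    rw [hn, List.length_cons, Nat.add_comm]

end Comp

/-! ### Leftist heaps -/

namespace Heap

variable {K V : Type}

/-- The entries of a heap. -/
def entries : Heap K V → Multiset (Entry K V)
  | nil => 0
  | node _ e l r => e ::ₘ (l.entries + r.entries)

/-- A leftist heap: the stored ranks are the lengths of the right spines, the rank of a left child is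
at least that of its sibling, and no key is smaller than the key at the root. -/
def Valid [LinearOrder K] : Heap K V → Prop
  | nil => True
  | node k e l r => k = r.rank + 1 ∧ r.rank ≤ l.rank ∧ (∀ x ∈ l.entries + r.entries, e.key ≤ x.key) ∧
      l.Valid ∧ r.Valid

theorem card_entries (h : Heap K V) : Multiset.card h.entries = h.size := by
  induction h with
  | nil => rfl
  | node k e l r hl hr => simp [entries, size, hl, hr]

theorem entries_mkNode (e : Entry K V) (a b : Heap K V) :
    (mkNode e a b).entries = e ::ₘ (a.entries + b.entries) := by
  unfold mkNode
  split_ifs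
  · rfl
  · simp [entries, add_comm]

variable [LinearOrder K]

/-- A leftist heap of rank `k` has at least `2 ^ k - 1` entries, because both children of the root have
rank at least `k - 1`. -/
theorem Valid.two_pow_rank_le {h : Heap K V} (hh : h.Valid) : 2 ^ h.rank ≤ h.size + 1 := by
  induction h with
  | nil => simp [rank, size]
  | node k e l r hl hr =>
    obtain ⟨rfl, h2, -, h4, h5⟩ := hh
    have h6 := hl h4
    have h7 := hr h5
    have h8 : 2 ^ r.rank ≤ 2 ^ l.rank := Nat.pow_le_pow_right (by norm_num) h2
    simp only [rank, size, pow_succ] at *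
    omega

theorem Valid.rank_le_log {h : Heap K V} (hh : h.Valid) {n : ℕ} (hn : h.size ≤ n) :
    h.rank ≤ Nat.log 2 (n + 1) :=
  Nat.le_log_of_pow_le (by norm_num) (hh.two_pow_rank_le.trans (by omega))

theorem Valid.mkNode {e : Entry K V} {a b : Heap K V} (ha : a.Valid) (hb : b.Valid)
    (h : ∀ x ∈ a.entries + b.entries, e.key ≤ x.key) : (mkNode e a b).Valid := by
  unfold Heap.mkNode
  split_ifs with hr
  · exact ⟨rfl, hr, h, ha, hb⟩
  · exact ⟨rfl, (not_le.1 hr).le, by rwa [add_comm], hb, ha⟩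

theorem Valid.single (e : Entry K V) : (single e).Valid :=
  ⟨rfl, le_rfl, by simp [entries], trivial, trivial⟩

theorem Valid.le_key {k : ℕ} {e : Entry K V} {l r : Heap K V} (h : (node k e l r).Valid) :
    ∀ x ∈ (node k e l r).entries, e.key ≤ x.key := by
  intro x hx
  rcases Multiset.mem_cons.1 hx with rfl | hx
  · exact le_rfl
  · exact h.2.2.1 x hx

theorem ens_merge (a b : Heap K V) (ha : a.Valid) (hb : b.Valid) :
    (a.merge b).Ens fun h n => h.Valid ∧ h.entries = a.entries + b.entries ∧
      n ≤ a.rank + b.rank + 1 := by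
  fun_induction merge a b with
  | case1 h =>
    exact ens_tick_bind (ens_pure ⟨hb, by simp [entries], by omega⟩)
  | case2 k e l r =>
    exact ens_tick_bind (ens_pure ⟨ha, by simp [entries], by omega⟩)
  | case3 ra a la ra' rb b lb rb' ih ih' =>
    refine ens_tick_bind ?_
    split_ifs with hab
    · obtain ⟨rfl, h2, h3, h4, h5⟩ := ha
      refine ens_bind ((ih h5 hb).mono fun h n hn => ens_pure ⟨?_, ?_, ?_⟩)
      · refine Valid.mkNode h4 hn.1 fun x hx => ?_
        rw [hn.2.1, ← add_assoc, Multiset.mem_add] at hx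
        rcases hx with hx | hx
        · exact h3 x hx
        · exact hab.trans (hb.le_key x hx)
      · rw [entries_mkNode, hn.2.1]
        simp only [entries, Multiset.cons_add, add_assoc]
      · have := hn.2.2
        simp only [rank] at this ⊢
        omega
    · obtain ⟨rfl, h2, h3, h4, h5⟩ := hb
      refine ens_bind ((ih' ha h5).mono fun h n hn => ens_pure ⟨?_, ?_, ?_⟩)
      · refine Valid.mkNode h4 hn.1 fun x hx => ?_
        rw [hn.2.1, add_left_comm, Multiset.mem_add] at hx
        rcases hx with hx | hx
        · exact (not_le.1 hab).le.trans (ha.le_key x hx)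
        · exact h3 x hx
      · rw [entries_mkNode, hn.2.1]
        simp only [entries]
        rw [Multiset.add_cons, add_left_comm]
      · have := hn.2.2
        simp only [rank] at this ⊢
        omega

end Heap

/-! ### Dijkstra's algorithm -/

namespace Network

variable {V : Type} [DecidableEq V]

/-- What is used of a network: the graph is undirected and its degrees are at most eight, costs and
weights do not depend on the direction, costs are positive and weights are nonnegative. -/
structure Regular (N : Network V) : Prop where
  nbrs_symm : ∀ u v, v ∈ N.nbrs u → u ∈ N.nbrs v
  nbrs_mem : ∀ u v, v ∈ N.nbrs u → v ∈ N.verts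
  length_nbrs_le : ∀ u, (N.nbrs u).length ≤ 8
  cost_symm : ∀ u v, N.cost u v = N.cost v u
  weight_symm : ∀ u v, N.weight u v = N.weight v u
  cost_pos : ∀ u v, v ∈ N.nbrs u → 0 < N.cost u v
  weight_nonneg : ∀ u v, 0 ≤ N.weight u v
  src_mem : N.src ∈ N.verts

variable {K : Type} [AddCommMonoid K] [LinearOrder K] [IsOrderedCancelAddMonoid K]

/-- `N.Reach alive len v w k`: some walk from `v` to `w` through present vertices has length `k`. -/
inductive Reach (N : Network V) (alive : V → Bool) (len : V → V → K) (v : V) : V → K → Prop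
  | refl : Reach N alive len v v 0
  | snoc {u w : V} {k : K} : Reach N alive len v u k → w ∈ N.nbrs u → alive w = true →
      Reach N alive len v w (k + len u w)

/-- A possible entry of the tables: the vertex `w` gets the distance `k`, either as the root or from a
settled neighbour `p`. -/
def Candidate (N : Network V) (len : V → V → K) (v : V) (T : Tables K V) (w : V) (p : Option V)
    (k : K) : Prop :=
  (w = v ∧ p = none ∧ k = 0) ∨
    ∃ u d, p = some u ∧ T.dist u = some d ∧ k = d + len u w ∧ w ∈ N.nbrs u

/-- The settled vertices carry their true distances and predecessors. -/
structure Sound (N : Network V) (alive : V → Bool) (len : V → V → K) (v : V) (T : Tables K V) :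
    Prop where
  present : ∀ w d, T.dist w = some d → alive w = true
  mem : ∀ w d, T.dist w = some d → w ∈ N.verts
  cand : ∀ w d, T.dist w = some d → N.Candidate len v T w (T.parent w) d
  le : ∀ w d k, T.dist w = some d → N.Reach alive len v w k → d ≤ k

/-- The entries of the queue are present vertices with distances that come from settled vertices. -/
def QueueSound (N : Network V) (alive : V → Bool) (len : V → V → K) (v : V) (T : Tables K V)
    (h : Heap K V) : Prop :=
  h.Valid ∧ ∀ x ∈ h.entries, alive x.vert = true ∧ x.vert ∈ N.verts ∧
    N.Candidate len v T x.vert x.parent x.key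

/-- The vertex `w` is settled or waits in the queue with a distance of at most `k`. -/
def Covered (T : Tables K V) (h : Heap K V) (w : V) (k : K) : Prop :=
  (T.dist w).isSome ∨ ∃ x ∈ h.entries, x.vert = w ∧ x.key ≤ k

/-- The vertices that are not settled. -/
noncomputable def unsettled (N : Network V) (T : Tables K V) : Finset V :=
  N.verts.toFinset.filter fun w => (T.dist w).isNone

/-- The invariant of the main loop of Dijkstra's algorithm. -/
structure DijkstraInv (N : Network V) (alive : V → Bool) (len : V → V → K) (v : V)
    (h : Heap K V) (T : Tables K V) : Prop where
  sound : N.Sound alive len v T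
  queue : N.QueueSound alive len v T h
  root : Covered T h v 0
  closed : ∀ u d w, T.dist u = some d → w ∈ N.nbrs u → alive w = true →
    Covered T h w (d + len u w)
  size_le : h.size + 8 * (N.unsettled T).card ≤ 8 * N.verts.length + 1

/-- A bound for the ranks of the heaps that occur on `n` vertices. -/
def rankBound (n : ℕ) : ℕ := Nat.log 2 (8 * n + 2)

/-- A bound for the time of Dijkstra's algorithm on `n` vertices. -/
def dijkstraTime (n : ℕ) : ℕ := n + ((2 * rankBound n + 2) + n * (24 * rankBound n + 40) + 1)

section

variable {N : Network V} {alive : V → Bool} {len : V → V → K} {v : V}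

/-- As long as a reachable vertex is not settled, the queue holds an entry whose key is at most its
distance: consider the place where a walk leaves the settled vertices. -/
theorem DijkstraInv.settled_or_queued (hlen : ∀ u w, w ∈ N.nbrs u → 0 < len u w) {h : Heap K V}
    {T : Tables K V} (I : N.DijkstraInv alive len v h T) {w : V} {k : K}
    (hw : N.Reach alive len v w k) :
    (∃ d, T.dist w = some d ∧ d ≤ k) ∨ ∃ x ∈ h.entries, x.key ≤ k := by
  induction hw with
  | refl =>
    rcases I.root with h1 | ⟨x, hx, -, hk⟩
    · obtain ⟨d, hd⟩ := Option.isSome_iff_exists.1 h1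
      exact Or.inl ⟨d, hd, I.sound.le v d 0 hd Reach.refl⟩
    · exact Or.inr ⟨x, hx, hk⟩
  | snoc hu hadj hal ih =>
    rename_i u w k
    rcases ih with ⟨d, hd, hdk⟩ | ⟨x, hx, hk⟩
    · rcases I.closed u d w hd hadj hal with h1 | ⟨x, hx, -, hk⟩
      · obtain ⟨d', hd'⟩ := Option.isSome_iff_exists.1 h1
        exact Or.inl ⟨d', hd', I.sound.le w d' _ hd' (hu.snoc hadj hal)⟩
      · exact Or.inr ⟨x, hx, hk.trans (by gcongr)⟩
    · exact Or.inr ⟨x, hx, hk.trans (le_add_of_nonneg_right (hlen u w hadj).le)⟩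

theorem Candidate.update {T T' : Tables K V} {w : V} {p : Option V} {k : K}
    (hT : ∀ u d, T.dist u = some d → T'.dist u = some d) (h : N.Candidate len v T w p k) :
    N.Candidate len v T' w p k := by
  rcases h with h | ⟨u, d, h1, h2, h3⟩
  · exact Or.inl h
  · exact Or.inr ⟨u, d, h1, hT u d h2, h3⟩

theorem ens_relax (hN : N.Regular) (T : Tables K V) (x : Entry K V) (h₀ : Heap K V)
    (hx : T.dist x.vert = some x.key) (hq : N.QueueSound alive len v T h₀)
    (hsize : h₀.size + 8 ≤ 8 * N.verts.length + 1) :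
    (N.relax alive len T x h₀).Ens fun h n =>
      n ≤ 8 * (rankBound N.verts.length + 3) ∧ N.QueueSound alive len v T h ∧
      h₀.entries ≤ h.entries ∧ h.size ≤ h₀.size + 8 ∧
      ∀ w ∈ N.nbrs x.vert, alive w = true → Covered T h w (x.key + len x.vert w) := by
  have hdeg := hN.length_nbrs_le x.vert
  refine (ens_foldlM (fun l h => (∀ w ∈ l, w ∈ N.nbrs x.vert) ∧ N.QueueSound alive len v T h ∧
      h₀.entries ≤ h.entries ∧ h.size + l.length ≤ h₀.size + 8 ∧
      ∀ w ∈ N.nbrs x.vert, alive w = true → w ∈ l ∨ Covered T h w (x.key + len x.vert w))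
    (rankBound N.verts.length + 3) ?_ (N.nbrs x.vert) h₀
    ⟨fun w hw => hw, hq, le_rfl, by omega, fun w hw _ => Or.inl hw⟩).mono ?_
  · rintro w l h ⟨hl, ⟨hv, hq⟩, hle, hs, hc⟩
    refine ens_tick_bind ?_
    rw [List.length_cons] at hs
    split_ifs with hw
    · rw [Bool.and_eq_true] at hw
      refine (Heap.ens_merge _ _ hv (Heap.Valid.single _)).mono ?_
      rintro h' n ⟨hv', he, hn⟩
      have hrank : h.rank ≤ rankBound N.verts.length :=
        (hv.rank_le_log (n := 8 * N.verts.length + 1) (by omega))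
      have hsz : h'.size = h.size + 1 := by
        rw [← Heap.card_entries, he, Multiset.card_add, Heap.card_entries, Heap.card_entries]
        rfl
      have hmem : ∀ y, y ∈ h'.entries ↔ y ∈ h.entries ∨ y = ⟨x.key + len x.vert w, w, some x.vert⟩ := by
        intro y
        rw [he, Multiset.mem_add]
        simp [Heap.single, Heap.entries]
      refine ⟨?_, fun z hz => hl z (List.mem_cons_of_mem _ hz), ⟨hv', ?_⟩,
        hle.trans (he ▸ Multiset.le_add_right _ _), by omega, ?_⟩
      · have : (Heap.single (⟨x.key + len x.vert w, w, some x.vert⟩ : Entry K V)).rank = 1 := rfl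
        omega
      · intro y hy
        rcases (hmem y).1 hy with hy | rfl
        · exact hq y hy
        · exact ⟨hw.1, hN.nbrs_mem _ _ (hl w (by simp)),
            Or.inr ⟨x.vert, x.key, rfl, hx, rfl, hl w (by simp)⟩⟩
      · intro z hz hza
        rcases hc z hz hza with hzl | hcov | ⟨y, hy, hy'⟩
        · rcases List.mem_cons.1 hzl with rfl | hzl
          · exact Or.inr (Or.inr ⟨_, (hmem _).2 (Or.inr rfl), rfl, le_rfl⟩)
          · exact Or.inl hzl
        · exact Or.inr (Or.inl hcov)
        · exact Or.inr (Or.inr ⟨y, (hmem y).2 (Or.inl hy), hy'⟩)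
    · refine ens_pure ⟨by omega, fun z hz => hl z (List.mem_cons_of_mem _ hz), ⟨hv, hq⟩, hle,
        by omega, ?_⟩
      intro z hz hza
      rcases hc z hz hza with hzl | hcov
      · rcases List.mem_cons.1 hzl with rfl | hzl
        · refine Or.inr (Or.inl ?_)
          rw [hza, Bool.true_and, Option.isNone_iff_eq_none] at hw
          exact Option.isSome_iff_ne_none.2 hw
        · exact Or.inl hzl
      · exact Or.inr hcov
  · rintro h n ⟨hn, -, hq', hle, hs, hc⟩
    refine ⟨hn.trans (Nat.mul_le_mul_right _ hdeg), hq', hle, by simpa using hs, fun w hw hwa => ?_⟩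
    exact (hc w hw hwa).resolve_left (by simp)

/-- Settling the least entry of the queue preserves the invariant, up to the relaxation of its
edges. -/
theorem DijkstraInv.sound_update (hlen : ∀ u w, w ∈ N.nbrs u → 0 < len u w) {k : ℕ} {x : Entry K V}
    {l r : Heap K V} {T : Tables K V} (I : N.DijkstraInv alive len v (Heap.node k x l r) T)
    (hx : T.dist x.vert = none) :
    N.Sound alive len v
      { dist := Function.update T.dist x.vert (some x.key)
        parent := Function.update T.parent x.vert x.parent } := by
  have hxe : x ∈ (Heap.node k x l r).entries := Multiset.mem_cons_self _ _
  obtain ⟨h1, h2, h3⟩ := I.queue.2 x hxe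
  have hT : ∀ u d, T.dist u = some d →
      Function.update T.dist x.vert (some x.key) u = some d := by
    intro u d hu
    rw [Function.update_of_ne (by rintro rfl; simp [hx] at hu), hu]
  have key_le : ∀ k', N.Reach alive len v x.vert k' → x.key ≤ k' := by
    intro k' hr
    rcases I.settled_or_queued hlen hr with ⟨d, hd, -⟩ | ⟨y, hy, hyk⟩
    · rw [hx] at hd
      cases hd
    · exact (I.queue.1.le_key y hy).trans hyk
  refine ⟨fun w d hw => ?_, fun w d hw => ?_, fun w d hw => ?_, fun w d k' hw hr => ?_⟩
  all_goals
    by_cases hwx : w = x.vert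
    · subst hwx
      simp only [Function.update_self, Option.some.injEq] at hw
      subst hw
      first
        | exact h1
        | exact h2
        | (simp only [Function.update_self]; exact h3.update hT)
        | exact key_le k' hr
    · simp only [Function.update_of_ne hwx] at hw
      first
        | exact I.sound.present w d hw
        | exact I.sound.mem w d hw
        | (simp only [Function.update_of_ne hwx]; exact (I.sound.cand w d hw).update hT)
        | exact I.sound.le w d k' hw hr

theorem card_unsettled_update {T : Tables K V} {p : V → Option V} {w : V} {k : K}
    (hw : T.dist w = none) (hmem : w ∈ N.verts) :
    (N.unsettled { dist := Function.update T.dist w (some k), parent := p }).card + 1 ≤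
      (N.unsettled T).card := by
  rw [Nat.add_one_le_iff]
  refine Finset.card_lt_card ((Finset.ssubset_iff_of_subset ?_).2 ⟨w, ?_, ?_⟩)
  · intro z hz
    simp only [unsettled, Finset.mem_filter] at hz ⊢
    refine ⟨hz.1, ?_⟩
    by_cases hzw : z = w
    · subst hzw; simp at hz
    · simpa [Function.update_of_ne hzw] using hz.2
  · simp [unsettled, hw, hmem]
  · simp [unsettled]

/-- Dijkstra's algorithm finds the distances from `v` to all vertices that can be reached. -/
theorem ens_dijkstra (hN : N.Regular) (hlen : ∀ u w, w ∈ N.nbrs u → 0 < len u w)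
    (hva : alive v = true) (hvm : v ∈ N.verts) :
    (N.dijkstra alive len v).Ens fun T n =>
      n ≤ dijkstraTime N.verts.length ∧ N.Sound alive len v T ∧
        ∀ w k, N.Reach alive len v w k → (T.dist w).isSome := by
  unfold dijkstra
  refine ens_bind ((ens_forM_tick _).mono fun _ n hn => ?_)
  subst hn
  set R := rankBound N.verts.length with hR
  have hun : ∀ T : Tables K V, (N.unsettled T).card ≤ N.verts.length := fun T =>
    (Finset.card_filter_le _ _).trans (List.toFinset_card_le _)
  refine (ens_loop (γ := Unit) (fun _ st => N.DijkstraInv alive len v st.1 st.2)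
    (fun _ st => st.1.size * (2 * R + 2) + (N.unsettled st.2).card * (24 * R + 40) + 1)
    (fun T => N.Sound alive len v T ∧ ∀ w k, N.Reach alive len v w k → (T.dist w).isSome)
    ?_ (g := ()) ?_).mono ?_
  · rintro - ⟨h, T⟩ I
    cases h with
    | nil =>
      refine ens_pure (Or.inr ⟨T, rfl, ⟨I.sound, fun w k hw => ?_⟩, by omega⟩)
      rcases I.settled_or_queued hlen hw with ⟨d, hd, -⟩ | ⟨y, hy, -⟩
      · exact Option.isSome_iff_exists.2 ⟨d, hd⟩
      · exact absurd hy (Multiset.notMem_zero y)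
    | node k x l r =>
      have hval := I.queue.1
      have hsize := I.size_le
      simp only [Heap.size] at hsize
      have hl : l.rank ≤ R := hval.2.2.2.1.rank_le_log (n := 8 * N.verts.length + 1) (by omega)
      have hr : r.rank ≤ R := hval.2.2.2.2.rank_le_log (n := 8 * N.verts.length + 1) (by omega)
      refine ens_bind ((Heap.ens_merge l r hval.2.2.2.1 hval.2.2.2.2).mono ?_)
      rintro h n ⟨hv, he, hn⟩
      have hsz : h.size = l.size + r.size := by
        rw [← Heap.card_entries, he, Multiset.card_add, Heap.card_entries, Heap.card_entries]
      have hmem : ∀ y, y ∈ (Heap.node k x l r).entries ↔ y = x ∨ y ∈ h.entries := by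
        intro y
        rw [he]
        exact Multiset.mem_cons
      have hq : N.QueueSound alive len v T h :=
        ⟨hv, fun y hy => I.queue.2 y ((hmem y).2 (Or.inr hy))⟩
      split_ifs with hx
      · refine ens_pure (Or.inl ⟨_, rfl, (), ⟨I.sound, hq, ?_, ?_, by dsimp only; omega⟩, ?_⟩)
        · rcases I.root with h1 | ⟨y, hy, hyv, hyk⟩
          · exact Or.inl h1
          · rcases (hmem y).1 hy with rfl | hy
            · exact Or.inl (hyv ▸ hx)
            · exact Or.inr ⟨y, hy, hyv, hyk⟩
        · intro u d w hu hw hwa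
          rcases I.closed u d w hu hw hwa with h1 | ⟨y, hy, hyv, hyk⟩
          · exact Or.inl h1
          · rcases (hmem y).1 hy with rfl | hy
            · exact Or.inl (hyv ▸ hx)
            · exact Or.inr ⟨y, hy, hyv, hyk⟩
        · simp only [Heap.size, hsz]
          nlinarith
      · rw [Option.not_isSome_iff_eq_none] at hx
        obtain ⟨h1, h2, h3⟩ := I.queue.2 x ((hmem x).2 (Or.inl rfl))
        have hsound := I.sound_update hlen hx
        have hcard := card_unsettled_update (N := N) (T := T)
          (p := Function.update T.parent x.vert x.parent) (k := x.key) hx h2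
        set T' : Tables K V :=
          { dist := Function.update T.dist x.vert (some x.key)
            parent := Function.update T.parent x.vert x.parent } with hT'
        have hT : ∀ u d, T.dist u = some d → T'.dist u = some d := by
          intro u d hu
          rw [hT']
          simp only
          rw [Function.update_of_ne (by rintro rfl; simp [hx] at hu), hu]
        have hxT : T'.dist x.vert = some x.key := by simp [hT']
        have hcov : ∀ w k', Covered T (Heap.node k x l r) w k' → Covered T' h w k' := by
          rintro w k' (hs | ⟨y, hy, hyv, hyk⟩)
          · obtain ⟨d, hd⟩ := Option.isSome_iff_exists.1 hs
            exact Or.inl (by simp [hT w d hd])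
          · rcases (hmem y).1 hy with rfl | hy
            · exact Or.inl (by rw [← hyv, hxT]; rfl)
            · exact Or.inr ⟨y, hy, hyv, hyk⟩
        refine ens_bind ((ens_relax hN T' x h hxT
          ⟨hv, fun y hy => ⟨(hq.2 y hy).1, (hq.2 y hy).2.1, (hq.2 y hy).2.2.update hT⟩⟩
          (by omega)).mono ?_)
        rintro h' m ⟨hm, hq', hle, hs', hc'⟩
        have hup : ∀ w k', Covered T' h w k' → Covered T' h' w k' := by
          rintro w k' (hs | ⟨y, hy, hy'⟩)
          · exact Or.inl hs
          · exact Or.inr ⟨y, Multiset.mem_of_le hle hy, hy'⟩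
        refine ens_pure (Or.inl ⟨_, rfl, (), ⟨hsound, hq', hup _ _ (hcov _ _ I.root), ?_, ?_⟩, ?_⟩)
        · intro u d w hu hw hwa
          by_cases hux : u = x.vert
          · subst hux
            rw [hxT] at hu
            cases hu
            exact hc' w hw hwa
          · rw [hT'] at hu
            simp only [Function.update_of_ne hux] at hu
            exact hup _ _ (hcov _ _ (I.closed u d w hu hw hwa))
        · dsimp only
          omega
        · simp only [Heap.size]
          have e1 : h'.size * (2 * R + 2) ≤ (l.size + r.size + 8) * (2 * R + 2) :=
            Nat.mul_le_mul_right _ (by omega)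
          have e2 : ((N.unsettled T').card + 1) * (24 * R + 40) ≤
              (N.unsettled T).card * (24 * R + 40) := Nat.mul_le_mul_right _ hcard
          nlinarith
  · refine ⟨⟨?_, ?_, ?_, ?_⟩, ⟨Heap.Valid.single _, ?_⟩, ?_, ?_, ?_⟩
    · simp
    · simp
    · simp
    · simp
    · intro y hy
      simp only [Heap.single, Heap.entries, add_zero, Multiset.cons_zero,
        Multiset.mem_singleton] at hy
      subst hy
      exact ⟨hva, hvm, Or.inl ⟨rfl, rfl, rfl⟩⟩
    · exact Or.inr ⟨⟨0, v, none⟩, by simp [Heap.single, Heap.entries], rfl, le_rfl⟩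
    · simp
    · have := hun { dist := fun _ => none, parent := fun _ => none }
      simp only [Heap.single, Heap.size]
      omega
  · rintro T m ⟨⟨h1, h2⟩, hm⟩
    refine ⟨?_, h1, h2⟩
    have := hun { dist := fun _ => none, parent := fun _ => none }
    have e2 := Nat.mul_le_mul_right (24 * R + 40) this
    simp only [Heap.single, Heap.size] at hm
    unfold dijkstraTime
    rw [← hR]
    omega

end

end Network

/-! ### Walks as lists of vertices -/

namespace Network

variable {V : Type} [DecidableEq V]

/-- The total length along a list of vertices. -/
def walkLen {K : Type} [Zero K] [Add K] (len : V → V → K) : List V → K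
  | u :: v :: l => len u v + walkLen len (v :: l)
  | _ => 0

/-- The list `l` is a walk from `u` to `w` through present vertices. -/
structure IsWalk (N : Network V) (alive : V → Bool) (u w : V) (l : List V) : Prop where
  head : l.head? = some u
  last : l.getLast? = some w
  present : ∀ x ∈ l, alive x = true
  chain : l.IsChain fun a b => b ∈ N.nbrs a

section

variable {N : Network V} {alive : V → Bool} {K : Type} [AddCommMonoid K]

theorem walkLen_append (len : V → V → K) (v : V) (b : List V) :
    ∀ a : List V, walkLen len (a ++ v :: b) = walkLen len (a ++ [v]) + walkLen len (v :: b)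
  | [] => by simp [walkLen]
  | [x] => by simp [walkLen]
  | x :: y :: a => by
    have := walkLen_append len v b (y :: a)
    simp only [List.cons_append] at this
    simp only [List.cons_append, walkLen, this, add_assoc]

theorem walkLen_reverse {len : V → V → K} (h : ∀ u v, len u v = len v u) :
    ∀ l : List V, walkLen len l.reverse = walkLen len l
  | [] => rfl
  | [_] => rfl
  | x :: y :: l => by
    have := walkLen_reverse h (y :: l)
    rw [List.reverse_cons] at this
    rw [List.reverse_cons, List.reverse_cons, List.append_assoc, List.singleton_append,
      walkLen_append, this]
    simp only [walkLen]
    rw [add_zero, h y x, add_comm]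

theorem walkLen_nonneg [LinearOrder K] [IsOrderedCancelAddMonoid K] {len : V → V → K}
    (hlen : ∀ u w, w ∈ N.nbrs u → 0 ≤ len u w) :
    ∀ l : List V, (l.IsChain fun a b => b ∈ N.nbrs a) → 0 ≤ walkLen len l
  | [], _ => le_rfl
  | [_], _ => le_rfl
  | x :: y :: l, h => by
    rw [List.isChain_cons_cons] at h
    exact add_nonneg (hlen _ _ h.1) (walkLen_nonneg hlen (y :: l) h.2)

theorem IsWalk.singleton {v : V} (h : alive v = true) : N.IsWalk alive v v [v] :=
  ⟨rfl, rfl, by simpa using h, List.isChain_singleton v⟩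

theorem IsWalk.reverse (hN : N.Regular) {u w : V} {l : List V} (h : N.IsWalk alive u w l) :
    N.IsWalk alive w u l.reverse := by
  refine ⟨by rw [List.head?_reverse, h.last], by rw [List.getLast?_reverse, h.head],
    fun x hx => h.present x (List.mem_reverse.1 hx), ?_⟩
  rw [List.isChain_reverse]
  exact h.chain.imp fun a b hab => hN.nbrs_symm a b hab

theorem IsWalk.split_left {u w v : V} {a b : List V} (h : N.IsWalk alive u w (a ++ v :: b)) :
    N.IsWalk alive u v (a ++ [v]) := by
  have e : a ++ v :: b = (a ++ [v]) ++ b := by simp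
  refine ⟨?_, by simp, fun x hx => h.present x (by rw [e]; exact List.mem_append_left _ hx), ?_⟩
  · have := h.head
    cases a <;> simpa using this
  · have := h.chain
    rw [e] at this
    exact this.left_of_append

theorem IsWalk.split_right {u w v : V} {a b : List V} (h : N.IsWalk alive u w (a ++ v :: b)) :
    N.IsWalk alive v w (v :: b) := by
  refine ⟨rfl, ?_, fun x hx => h.present x (List.mem_append_right _ hx),
    h.chain.right_of_append⟩
  have := h.last
  simpa [List.getLast?_append] using this

theorem IsWalk.append {u w v : V} {a b : List V} (h : N.IsWalk alive u v (a ++ [v]))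
    (h' : N.IsWalk alive v w (v :: b)) : N.IsWalk alive u w (a ++ v :: b) := by
  refine ⟨?_, ?_, ?_, ?_⟩
  · have := h.head
    cases a <;> simpa using this
  · have := h'.last
    simpa [List.getLast?_append] using this
  · intro x hx
    rcases List.mem_append.1 hx with hx | hx
    · exact h.present x (List.mem_append_left _ hx)
    · exact h'.present x hx
  · have := h.chain
    have h2 := h'.chain
    rw [List.isChain_split]
    exact ⟨this, h2⟩

theorem IsWalk.mono {alive' : V → Bool} (hle : ∀ v, alive' v = true → alive v = true) {u w : V}
    {l : List V} (h : N.IsWalk alive' u w l) : N.IsWalk alive u w l :=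
  ⟨h.head, h.last, fun x hx => hle x (h.present x hx), h.chain⟩

theorem IsWalk.mem_verts (hN : N.Regular) {u w : V} {l : List V} (h : N.IsWalk alive u w l)
    (hu : u ∈ N.verts) : ∀ x ∈ l, x ∈ N.verts := by
  have key : ∀ (l : List V) (u : V), l.head? = some u → u ∈ N.verts →
      (l.IsChain fun a b => b ∈ N.nbrs a) → ∀ x ∈ l, x ∈ N.verts := by
    intro l
    induction l with
    | nil => simp
    | cons y l ih =>
      intro u hh hu hc x hx
      cases hh
      rcases List.mem_cons.1 hx with rfl | hx
      · exact hu
      · cases l with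
        | nil => cases hx
        | cons z l =>
          rw [List.isChain_cons_cons] at hc
          exact ih z rfl (hN.nbrs_mem _ _ hc.1) hc.2 x hx
  exact key l u h.head hu h.chain

theorem IsWalk.reach {len : V → V → K} {v w : V} {l : List V} (h : N.IsWalk alive v w l) :
    N.Reach alive len v w (walkLen len l) := by
  have key : ∀ (l : List V) (u : V) (k : K), l.head? = some u → l.getLast? = some w →
      (∀ x ∈ l, alive x = true) → (l.IsChain fun a b => b ∈ N.nbrs a) →
      N.Reach alive len v u k → N.Reach alive len v w (k + walkLen len l) := by
    intro l
    induction l with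
    | nil => simp
    | cons y l ih =>
      intro u k hh hl hp hc hr
      cases hh
      cases l with
      | nil =>
        cases hl
        simpa [walkLen] using hr
      | cons z l =>
        rw [List.isChain_cons_cons] at hc
        rw [walkLen, ← add_assoc]
        refine ih z _ rfl (by simpa using hl) (fun x hx => hp x (List.mem_cons_of_mem _ hx)) hc.2
          (hr.snoc hc.1 (hp z (by simp)))
  simpa using key l v 0 h.head h.last h.present h.chain Reach.refl

end

theorem walkLen_lenAt (N : Network V) (lam : ℝ) :
    ∀ l : List V, walkLen (N.lenAt lam) l = walkLen N.cost l + lam * walkLen N.weight l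
  | [] => by simp [walkLen]
  | [_] => by simp [walkLen]
  | x :: y :: l => by
    simp only [walkLen, walkLen_lenAt N lam (y :: l), lenAt]
    ring

theorem walkLen_lenInf (N : Network V) :
    ∀ l : List V, walkLen N.lenInf l = toLex (walkLen N.weight l, walkLen N.cost l)
  | [] => rfl
  | [_] => rfl
  | x :: y :: l => by
    simp only [walkLen, walkLen_lenInf N (y :: l), lenInf]
    rfl

/-! ### Routes -/

section

variable {N : Network V} {alive : V → Bool} {v : V}
variable {K : Type} [AddCommMonoid K] [LinearOrder K] [IsOrderedCancelAddMonoid K] {len : V → V → K}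

theorem ens_pathTo_none {T : Tables K V} {w : V} (h : T.dist w = none) :
    (pathTo T w).Ens fun r n => r = none ∧ n = 1 := by
  unfold pathTo
  rw [h]
  exact ens_tick_bind (ens_pure ⟨rfl, rfl⟩)

/-- Following the predecessors leads back to the root along a shortest path.  Distances decrease
strictly on the way, so that no vertex is visited twice. -/
theorem ens_pathTo_some (hlen : ∀ u w, w ∈ N.nbrs u → 0 < len u w) {T : Tables K V}
    (hT : N.Sound alive len v T) {w : V} {d : K} (h : T.dist w = some d) :
    (pathTo T w).Ens fun r n => n ≤ N.verts.length ∧ ∃ l, r = some l ∧ N.IsWalk alive v w l ∧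
      walkLen len l = d ∧ l.Nodup ∧ l.length ≤ N.verts.length := by
  unfold pathTo
  rw [h]
  have hcard : ∀ l : List V, l.Nodup → (∀ x ∈ l, x ∈ N.verts) → l.length ≤ N.verts.length :=
    fun l hl hm => (List.subperm_of_subset hl hm).length_le
  refine ens_bind ((ens_loop (γ := Unit)
    (fun _ st => (∃ k, T.dist st.1 = some k ∧ k + walkLen len (st.1 :: st.2) = d ∧
        ∀ x ∈ st.2, ∃ k', T.dist x = some k' ∧ k < k') ∧
      N.IsWalk alive st.1 w (st.1 :: st.2) ∧ (st.1 :: st.2).Nodup ∧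
      ∀ x ∈ st.1 :: st.2, x ∈ N.verts)
    (fun _ st => N.verts.length - st.2.length)
    (fun l => N.IsWalk alive v w l ∧ walkLen len l = d ∧ l.Nodup ∧ l.length ≤ N.verts.length)
    ?_ (g := ()) ?_).mono ?_)
  · rintro - ⟨u, l⟩ ⟨⟨k, hk, hkd, hlt⟩, hw, hnd, hmem⟩
    have hle := hcard _ hnd hmem
    simp only [List.length_cons] at hle
    rcases hT.cand u k hk with ⟨rfl, hp, rfl⟩ | ⟨u', k', hp, hk', rfl, hadj⟩
    · simp only [hp]
      refine ens_pure (Or.inr ⟨_, rfl, ⟨hw, by simpa using hkd, hnd, hle⟩, by omega⟩)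
    · simp only [hp]
      have hlt' : k' < k' + len u' u := lt_add_of_pos_right _ (hlen _ _ hadj)
      have hnew : ∀ x ∈ u :: l, ∃ k'', T.dist x = some k'' ∧ k' < k'' := by
        intro x hx
        rcases List.mem_cons.1 hx with rfl | hx
        · exact ⟨_, hk, hlt'⟩
        · obtain ⟨k'', h1, h2⟩ := hlt x hx
          exact ⟨k'', h1, hlt'.trans h2⟩
      have hnd' : (u' :: u :: l).Nodup := by
        refine List.nodup_cons.2 ⟨fun hmem' => ?_, hnd⟩
        obtain ⟨k'', h1, h2⟩ := hnew u' hmem'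
        rw [hk'] at h1
        cases h1
        exact lt_irrefl _ h2
      have hmem' : ∀ x ∈ u' :: u :: l, x ∈ N.verts := by
        intro x hx
        rcases List.mem_cons.1 hx with rfl | hx
        · exact hT.mem _ _ hk'
        · exact hmem x hx
      have hle' := hcard _ hnd' hmem'
      simp only [List.length_cons] at hle'
      refine ens_pure (Or.inl ⟨_, rfl, (), ⟨⟨k', hk', ?_, hnew⟩, ⟨rfl, ?_, ?_, ?_⟩, hnd', hmem'⟩, ?_⟩)
      · rw [walkLen, ← add_assoc]
        exact hkd
      · have := hw.last
        simpa using this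
      · intro x hx
        rcases List.mem_cons.1 hx with rfl | hx
        · exact hT.present _ _ hk'
        · exact hw.present x hx
      · exact List.isChain_cons_cons.2 ⟨hadj, hw.chain⟩
      · simp only [List.length_cons]
        omega
  · refine ⟨⟨d, h, by simp [walkLen], by simp⟩, IsWalk.singleton (hT.present _ _ h), by simp, ?_⟩
    simpa using hT.mem _ _ h
  · rintro l n ⟨hl, hn⟩
    exact ens_pure ⟨by simpa using hn, l, rfl, hl⟩

theorem ens_reverseOnto : ∀ a b : List V,
    (reverseOnto a b).Ens fun l n => l = a.reverse ++ b ∧ n = a.length + 1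
  | [], b => ens_tick_bind (ens_pure ⟨rfl, rfl⟩)
  | x :: a, b => by
    refine ens_tick_bind ((ens_reverseOnto a (x :: b)).mono ?_)
    rintro l n ⟨rfl, rfl⟩
    refine ⟨by simp, by simp; omega⟩

theorem ens_measure (N : Network V) : ∀ l : List V,
    (N.measure l).Ens fun m n => m = (walkLen N.cost l, walkLen N.weight l) ∧ n ≤ l.length + 1
  | [] => ens_tick_bind (ens_pure ⟨rfl, by simp⟩)
  | [x] => ens_tick_bind (ens_pure ⟨rfl, by simp⟩)
  | x :: y :: l => by
    rw [measure]
    refine ens_tick_bind (ens_bind ((ens_measure N (y :: l)).mono ?_))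
    rintro m n ⟨rfl, hn⟩
    refine ens_pure ⟨rfl, ?_⟩
    simp only [List.length_cons] at hn ⊢
    omega

/-- The route `q` is a walk from source to target through present vertices, with its true cost and
weight, and with at most `2 |V|` vertices. -/
structure IsRoute (N : Network V) (alive : V → Bool) (q : Route V) : Prop where
  walk : N.IsWalk alive N.src N.dst q.verts
  cost : q.cost = walkLen N.cost q.verts
  weight : q.weight = walkLen N.weight q.verts
  length_le : q.verts.length ≤ 2 * N.verts.length

/-- A bound for the time in which a best route through a vertex is found. -/
def routeTime (n : ℕ) : ℕ := dijkstraTime n + 5 * n + 4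

/-- What `routeThrough` returns: nothing if no walk through `v` connects source and target, and
otherwise a shortest such walk, which for `v` the source repeats no vertex. -/
def BestRoute (N : Network V) (alive : V → Bool) (len : V → V → K) (v : V) :
    Option (Route V) → Prop
  | none => ∀ l, N.IsWalk alive N.src N.dst l → v ∉ l
  | some q => N.IsRoute alive q ∧ v ∈ q.verts ∧ (v = N.src → q.verts.Nodup) ∧
      ∀ l, N.IsWalk alive N.src N.dst l → v ∈ l → walkLen len q.verts ≤ walkLen len l

theorem ens_routeThrough (hN : N.Regular) (hlen : ∀ u w, w ∈ N.nbrs u → 0 < len u w)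
    (hsymm : ∀ u w, len u w = len w u) (hva : alive v = true) (hvm : v ∈ N.verts) :
    (N.routeThrough alive len v).Ens fun r n =>
      n ≤ routeTime N.verts.length ∧ N.BestRoute alive len v r := by
  unfold routeThrough
  have hpos : 1 ≤ N.verts.length := List.length_pos_of_mem hvm
  refine ens_bind ((ens_dijkstra hN hlen hva hvm).mono ?_)
  rintro T n ⟨hn, hT, hcomp⟩
  have split : ∀ l, N.IsWalk alive N.src N.dst l → v ∈ l → ∃ a b, l = a ++ v :: b ∧
      N.IsWalk alive v N.src (a ++ [v]).reverse ∧ N.IsWalk alive v N.dst (v :: b) := by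
    intro l hl hv
    obtain ⟨a, b, rfl⟩ := List.append_of_mem hv
    exact ⟨a, b, rfl, hl.split_left.reverse hN, hl.split_right⟩
  cases hs : T.dist N.src with
  | none =>
    refine ens_bind ((ens_pathTo_none hs).mono ?_)
    rintro _ m ⟨rfl, rfl⟩
    have hd : (pathTo T N.dst).Ens fun _ n => n ≤ N.verts.length := by
      cases hd : T.dist N.dst with
      | none => exact (ens_pathTo_none hd).mono fun _ _ h => h.2 ▸ hpos
      | some d => exact (ens_pathTo_some hlen hT hd).mono fun _ _ h => h.1
    refine ens_bind (hd.mono fun b k hk => ens_pure ⟨?_, ?_⟩)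
    · unfold routeTime; omega
    · intro l hl hv
      obtain ⟨a, b, -, h1, -⟩ := split l hl hv
      have := hcomp _ _ h1.reach
      simp [hs] at this
  | some ds =>
    refine ens_bind ((ens_pathTo_some hlen hT hs).mono ?_)
    rintro _ m ⟨hm, a, rfl, ha, hads, hand, hal⟩
    cases hd : T.dist N.dst with
    | none =>
      refine ens_bind ((ens_pathTo_none hd).mono ?_)
      rintro _ k ⟨rfl, rfl⟩
      refine ens_pure ⟨?_, ?_⟩
      · unfold routeTime; omega
      · intro l hl hv
        obtain ⟨a, b, -, -, h2⟩ := split l hl hv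
        have := hcomp _ _ h2.reach
        simp [hd] at this
    | some dd =>
      refine ens_bind ((ens_pathTo_some hlen hT hd).mono ?_)
      rintro _ k ⟨hk, b, rfl, hb, hbdd, hbnd, hbl⟩
      refine ens_bind ((ens_reverseOnto a b.tail).mono ?_)
      rintro _ i ⟨rfl, rfl⟩
      refine ens_bind ((ens_measure N _).mono ?_)
      rintro _ j ⟨rfl, hj⟩
      obtain ⟨b', rfl⟩ : ∃ b', b = v :: b' := by
        have := hb.head
        cases b with
        | nil => cases this
        | cons y b' => cases this; exact ⟨b', rfl⟩
      obtain ⟨a', rfl⟩ : ∃ a', a = v :: a' := by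
        have := ha.head
        cases a with
        | nil => cases this
        | cons y a' => cases this; exact ⟨a', rfl⟩
      have e : (v :: a').reverse ++ (v :: b').tail = a'.reverse ++ v :: b' := by simp
      have hrev := ha.reverse hN
      rw [List.reverse_cons] at hrev
      have hlensum : (a'.reverse ++ v :: b').length = (v :: a').length + b'.length := by
        simp; omega
      rw [e] at hj ⊢
      rw [hlensum] at hj
      simp only [List.length_cons] at hal hbl hj
      refine ens_pure ⟨?_, ⟨hrev.append hb, rfl, rfl, ?_⟩, by simp, ?_, ?_⟩
      · unfold routeTime
        simp only [List.length_cons]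
        omega
      · rw [hlensum, List.length_cons]
        omega
      · rintro rfl
        have : a' = [] := by
          by_contra hne
          have hlast := ha.last
          rw [List.getLast?_cons, List.getLast?_eq_getLast_of_ne_nil hne] at hlast
          simp only [Option.getD_some, Option.some.injEq] at hlast
          exact (List.nodup_cons.1 hand).1 (hlast ▸ List.getLast_mem hne)
        subst this
        simpa using hbnd
      · intro l hl hv
        obtain ⟨a'', b'', rfl, h1, h2⟩ := split l hl hv
        have e1 := hT.le _ _ _ hs h1.reach
        have e2 := hT.le _ _ _ hd h2.reach
        rw [walkLen_reverse hsymm] at e1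
        rw [walkLen_append len v b', walkLen_append len v b'', ← List.reverse_cons, walkLen_reverse hsymm, hads, hbdd]
        exact add_le_add e1 e2

end

/-! ### Cutting out closed detours -/

theorem ens_suffixFrom (x : V) : ∀ l : List V, (suffixFrom x l).Ens fun r n => n ≤ l.length + 1 ∧
    ((r = none ∧ x ∉ l) ∨ ∃ a b, r = some (x :: b) ∧ l = a ++ x :: b)
  | [] => ens_tick_bind (ens_pure ⟨by simp, Or.inl ⟨rfl, by simp⟩⟩)
  | y :: l => by
    rw [suffixFrom]
    refine ens_tick_bind ?_
    split_ifs with h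
    · subst h
      exact ens_pure ⟨by simp, Or.inr ⟨[], l, rfl, rfl⟩⟩
    · refine (ens_suffixFrom x l).mono ?_
      rintro r n ⟨hn, ⟨rfl, hx⟩ | ⟨a, b, rfl, rfl⟩⟩
      · refine ⟨by simp only [List.length_cons]; omega, Or.inl ⟨rfl, by simp [h, hx]⟩⟩
      · refine ⟨by simp only [List.length_cons]; omega, Or.inr ⟨y :: a, b, rfl, rfl⟩⟩

/-- The list `l'` arises from the walk `l` by cutting out closed detours. -/
structure Shortcut (N : Network V) (l l' : List V) : Prop where
  head : l'.head? = l.head?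
  last : l'.getLast? = l.getLast?
  chain : l'.IsChain fun a b => b ∈ N.nbrs a
  nodup : l'.Nodup
  subset : ∀ x ∈ l', x ∈ l
  length_le : l'.length ≤ l.length
  le : ∀ len : V → V → ℝ, (∀ a b, b ∈ N.nbrs a → 0 ≤ len a b) → walkLen len l' ≤ walkLen len l

theorem ens_eraseLoops {N : Network V} : ∀ l : List V, (l.IsChain fun a b => b ∈ N.nbrs a) →
    (eraseLoops l).Ens fun l' n => n ≤ (l.length + 1) * (l.length + 2) ∧ N.Shortcut l l'
  | [], _ => ens_tick_bind (ens_pure ⟨by simp, by constructor <;> simp⟩)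
  | x :: l, hc => by
    rw [eraseLoops]
    refine ens_tick_bind (ens_bind ((ens_eraseLoops l hc.tail).mono ?_))
    rintro l' n ⟨hn, hl'⟩
    have hlen := hl'.length_le
    have hstep : ∀ len : V → V → ℝ, (∀ a b, b ∈ N.nbrs a → 0 ≤ len a b) →
        walkLen len l ≤ walkLen len (x :: l) := by
      intro len hl
      cases l with
      | nil => simp [walkLen]
      | cons y l =>
        rw [walkLen]
        exact le_add_of_nonneg_left (hl _ _ (List.isChain_cons_cons.1 hc).1)
    refine ens_bind ((ens_suffixFrom x l').mono ?_)
    rintro r m ⟨hm, ⟨rfl, hx⟩ | ⟨a, b, rfl, hab⟩⟩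
    · refine ens_pure ⟨?_, ⟨rfl, ?_, ?_, List.nodup_cons.2 ⟨hx, hl'.nodup⟩, ?_, ?_, ?_⟩⟩
      · simp only [List.length_cons]
        nlinarith
      · rw [List.getLast?_cons, List.getLast?_cons, hl'.last]
      · rw [List.isChain_cons]
        refine ⟨fun y hy => ?_, hl'.chain⟩
        rw [List.isChain_cons] at hc
        exact hc.1 y (hl'.head ▸ hy)
      · intro y hy
        rcases List.mem_cons.1 hy with rfl | hy
        · simp
        · exact List.mem_cons_of_mem _ (hl'.subset y hy)
      · simpa using hlen
      · intro len hl
        have h1 := hl'.le len hl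
        have h2 := hl'.head
        cases l with
        | nil =>
          cases l' with
          | nil => simp [walkLen]
          | cons y l' => cases h2
        | cons y l =>
          cases l' with
          | nil => cases h2
          | cons z l' =>
            cases h2
            rw [walkLen, walkLen]
            linarith
    · subst hab
      refine ens_pure ⟨?_, ⟨rfl, ?_, hl'.chain.right_of_append, hl'.nodup.of_append_right, ?_, ?_, ?_⟩⟩
      · simp only [List.length_cons]
        nlinarith
      · have h1 := hl'.last
        rw [List.getLast?_append, List.getLast?_cons, Option.some_or] at h1
        rw [List.getLast?_cons, List.getLast?_cons, ← h1, Option.getD_some]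
      · exact fun y hy => List.mem_cons_of_mem _ (hl'.subset y (List.mem_append_right _ hy))
      · simp only [List.length_append, List.length_cons] at hlen ⊢
        omega
      · intro len hl
        have h1 := hl'.le len hl
        rw [walkLen_append] at h1
        have h2 := walkLen_nonneg hl (a ++ [x])
          (List.isChain_split.1 hl'.chain).1
        linarith [hstep len hl]

end Network

/-! ### Rapidly decreasing values of a linear form on zero-one vectors -/

theorem sum_digits_lt {M : ℕ} (hM : 1 ≤ M) : ∀ (q : ℕ) (X : ℕ → ℝ) (e : ℕ → ℕ),
    (∀ i < q + 1, 0 < X i) → (∀ i < q, M * X (i + 1) ≤ X i) → (∀ i < q + 1, e i < M) →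
    ∑ i ∈ Finset.range (q + 1), e i * X i < M * X 0
  | 0, X, e, hX, _, he => by
    simp only [zero_add, Finset.sum_range_one]
    have : (e 0 : ℝ) < M := by exact_mod_cast he 0 (by omega)
    exact mul_lt_mul_of_pos_right this (hX 0 (by omega))
  | q + 1, X, e, hX, hd, he => by
    rw [Finset.sum_range_succ']
    have h1 := sum_digits_lt hM q (fun i => X (i + 1)) (fun i => e (i + 1))
      (fun i hi => hX _ (by omega)) (fun i hi => hd _ (by omega)) (fun i hi => he _ (by omega))
    have h2 := hd 0 (by omega)
    have h3 : (e 0 : ℝ) + 1 ≤ M := by exact_mod_cast he 0 (by omega)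
    have h4 := mul_le_mul_of_nonneg_right h3 (hX 0 (by omega)).le
    simp only [zero_add] at h1 h2
    linarith

/-- If each of the positive numbers `X i` is at least `M` times the next one, then they behave like the
powers of the base `M`: a sum of multiples with coefficients below `M` determines its coefficients. -/
theorem digits_unique {M : ℕ} (hM : 1 ≤ M) : ∀ (q : ℕ) (X : ℕ → ℝ) (e e' : ℕ → ℕ),
    (∀ i < q, 0 < X i) → (∀ i, i + 1 < q → M * X (i + 1) ≤ X i) → (∀ i < q, e i < M) →
    (∀ i < q, e' i < M) →
    ∑ i ∈ Finset.range q, e i * X i = ∑ i ∈ Finset.range q, e' i * X i → ∀ i < q, e i = e' i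
  | 0, _, _, _, _, _, _, _, _ => by simp
  | q + 1, X, e, e', hX, hd, he, he', hs => by
    have key : ∀ e e' : ℕ → ℕ, (∀ i < q + 1, e' i < M) →
        ∑ i ∈ Finset.range (q + 1), e i * X i = ∑ i ∈ Finset.range (q + 1), e' i * X i →
        e 0 ≤ e' 0 := by
      intro e e' he' hs
      by_contra! hlt
      rw [Finset.sum_range_succ', Finset.sum_range_succ'] at hs
      have h1 : 0 ≤ ∑ i ∈ Finset.range q, (e (i + 1) : ℝ) * X (i + 1) :=
        Finset.sum_nonneg fun i hi => mul_nonneg (Nat.cast_nonneg _)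
          (hX _ (by have := Finset.mem_range.1 hi; omega)).le
      have h2 : ∑ i ∈ Finset.range q, (e' (i + 1) : ℝ) * X (i + 1) < X 0 := by
        cases q with
        | zero => simpa using hX 0 (by omega)
        | succ q =>
          have h3 := sum_digits_lt hM q (fun i => X (i + 1)) (fun i => e' (i + 1))
            (fun i hi => hX _ (by omega)) (fun i hi => hd _ (by omega))
            (fun i hi => he' _ (by omega))
          exact h3.trans_le (hd 0 (by omega))
      have h3 : (e' 0 : ℝ) + 1 ≤ e 0 := by exact_mod_cast hlt
      have h4 := mul_le_mul_of_nonneg_right h3 (hX 0 (by omega)).le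
      linarith
    have h0 : e 0 = e' 0 := le_antisymm (key e e' he' hs) (key e' e he hs.symm)
    rw [Finset.sum_range_succ', Finset.sum_range_succ', h0, add_left_inj] at hs
    have ih := digits_unique hM q (fun i => X (i + 1)) (fun i => e (i + 1)) (fun i => e' (i + 1))
      (fun i hi => hX _ (by omega)) (fun i hi => hd _ (by omega)) (fun i hi => he _ (by omega))
      (fun i hi => he' _ (by omega)) hs
    intro i hi
    cases i with
    | zero => exact h0
    | succ i => exact ih i (by omega)

/-- If a linear form takes positive values on `q` zero-one vectors, each at least `M` times the next,
then the `M ^ q` combinations of these vectors with coefficients below `M` are distinct; they lie in a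
box, whose size bounds their number. -/
theorem pow_le_of_geometric {ι : Type*} [Fintype ι] {M q : ℕ} (hM : 1 ≤ M) (w : ι → ℝ)
    (y : ℕ → ι → ℕ) (hy : ∀ i a, y i a ≤ 1) (hpos : ∀ i < q, 0 < ∑ a, w a * y i a)
    (hgeo : ∀ i, i + 1 < q → M * ∑ a, w a * y (i + 1) a ≤ ∑ a, w a * y i a) :
    M ^ q ≤ (q * (M - 1) + 1) ^ Fintype.card ι := by
  classical
  let D : (Fin q → Fin M) → ℕ → ℕ := fun e i => if h : i < q then e ⟨i, h⟩ else 0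
  have hD : ∀ e, ∀ i < q, D e i < M := by
    intro e i hi
    simp only [D, dif_pos hi]
    exact (e ⟨i, hi⟩).2
  let F : (Fin q → Fin M) → ι → Fin (q * (M - 1) + 1) := fun e a =>
    ⟨∑ i ∈ Finset.range q, D e i * y i a, by
      have : ∑ i ∈ Finset.range q, D e i * y i a ≤ ∑ i ∈ Finset.range q, (M - 1) * 1 :=
        Finset.sum_le_sum fun i hi => Nat.mul_le_mul
          (by have := hD e i (Finset.mem_range.1 hi); omega) (hy i a)
      rw [Finset.sum_const, Finset.card_range, smul_eq_mul, mul_one] at this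
      omega⟩
  have hF : Function.Injective F := by
    intro e e' hee
    have hsum : ∀ e, ∑ i ∈ Finset.range q, (D e i : ℝ) * ∑ a, w a * y i a =
        ∑ a, w a * ((F e a : ℕ) : ℝ) := by
      intro e
      simp only [F, Finset.mul_sum, Nat.cast_sum, Nat.cast_mul]
      rw [Finset.sum_comm]
      exact Finset.sum_congr rfl fun a _ => Finset.sum_congr rfl fun i _ => by ring
    have := digits_unique hM q (fun i => ∑ a, w a * y i a) (D e) (D e') hpos hgeo (hD e) (hD e')
      (by rw [hsum, hsum, hee])
    funext i
    have h := this i i.2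
    simp only [D, dif_pos i.2] at h
    exact Fin.ext h
  simpa using Fintype.card_le_of_injective F hF

/-- A linear form in `p` variables can be halved at most `O(p log p)` times on zero-one vectors. -/
theorem not_halving {ι : Type*} [Fintype ι] {p : ℕ} (hp : Fintype.card ι = p) (hp0 : 0 < p)
    (w : ι → ℝ) (y : ℕ → ι → ℕ) (hy : ∀ i a, y i a ≤ 1)
    (hpos : ∀ i < 4 * p * (Nat.log 2 p + 2), 0 < ∑ a, w a * y i a)
    (hgeo : ∀ i, i + 1 < 4 * p * (Nat.log 2 p + 2) →
      2 * ∑ a, w a * y (i + 1) a ≤ ∑ a, w a * y i a) : False := by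
  have h := pow_le_of_geometric (M := 2) (q := 4 * p * (Nat.log 2 p + 2)) (by norm_num) w y hy hpos
    (by exact_mod_cast hgeo)
  rw [hp] at h
  set L := Nat.log 2 p + 1 with hL
  have hpL : p < 2 ^ L := Nat.lt_pow_succ_log_self (by norm_num) p
  have h1 : 4 * p * (L + 1) + 1 < 2 ^ (4 * (L + 1)) := by
    have h2 : L + 1 ≤ 2 ^ L := Nat.lt_two_pow_self
    have h3 : 4 * p * (L + 1) ≤ 4 * 2 ^ L * 2 ^ L := by gcongr
    have h4 : 2 ^ (4 * (L + 1)) = 16 * ((2 ^ L * 2 ^ L) * (2 ^ L * 2 ^ L)) := by ring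
    have h5 : 1 ≤ 2 ^ L * 2 ^ L := Nat.mul_pos (by positivity) (by positivity)
    nlinarith
  have h2 : 4 * p * (Nat.log 2 p + 2) = 4 * (L + 1) * p := by rw [hL]; ring
  rw [show Nat.log 2 p + 2 = L + 1 from rfl] at h
  rw [show 2 ^ (4 * p * (L + 1)) = (2 ^ (4 * (L + 1))) ^ p by rw [← pow_mul]; ring_nf] at h
  exact absurd h (not_le.2 (Nat.pow_lt_pow_left (by omega) hp0.ne'))

/-- A linear form in `p` variables can be divided by more than `2 p` at most `2 p` times on zero-one
vectors. -/
theorem not_steep {ι : Type*} [Fintype ι] {p : ℕ} (hp : Fintype.card ι = p) (hp0 : 0 < p)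
    (w : ι → ℝ) (y : ℕ → ι → ℕ) (hy : ∀ i a, y i a ≤ 1)
    (hpos : ∀ i < 2 * p + 1, 0 < ∑ a, w a * y i a)
    (hgeo : ∀ i, i + 1 < 2 * p + 1 →
      ((2 * p + 1 : ℕ) : ℝ) * ∑ a, w a * y (i + 1) a ≤ ∑ a, w a * y i a) : False := by
  have h := pow_le_of_geometric (M := 2 * p + 1) (q := 2 * p + 1) (by omega) w y hy hpos hgeo
  rw [hp, show 2 * p + 1 - 1 = 2 * p by omega] at h
  have h1 : (2 * p + 1) * (2 * p) + 1 ≤ (2 * p + 1) ^ 2 := by nlinarith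
  have h2 := h.trans (Nat.pow_le_pow_left h1 p)
  rw [← pow_mul] at h2
  exact absurd h2 (not_le.2 (Nat.pow_lt_pow_right (by omega) (by omega)))

/-! ### The number of Newton steps -/

/-- Newton steps on one side of the optimal multiplier.  The line `j` has intercept `c j` and slope
`g j`, and it is found at the multiplier `lam j`, where it is the lowest among itself and the later
lines.  It lies at or below the level `0` at `lam j`, and at or above that level at `lam (j + 1)`, where
the next line is strictly lower. -/
structure NewtonSeq (n : ℕ) (lam c g : ℕ → ℝ) : Prop where
  slope_pos : ∀ j ≤ n, 0 < g j
  below : ∀ j ≤ n, c j + lam j * g j ≤ 0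
  above : ∀ j < n, 0 ≤ c j + lam (j + 1) * g j
  improves : ∀ j < n, c (j + 1) + lam (j + 1) * g (j + 1) < c j + lam (j + 1) * g j
  lowest : ∀ i j, j ≤ i → i ≤ n → c j + lam j * g j ≤ c i + lam j * g i

namespace NewtonSeq

variable {n : ℕ} {lam c g : ℕ → ℝ}

/-- The depth of the line `j` below the level `0` at the multiplier where it is found. -/
def depth (lam c g : ℕ → ℝ) (j : ℕ) : ℝ := -(c j + lam j * g j)

theorem depth_nonneg (h : NewtonSeq n lam c g) {j : ℕ} (hj : j ≤ n) : 0 ≤ depth lam c g j := by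
  have := h.below j hj
  unfold depth
  linarith

theorem depth_le (h : NewtonSeq n lam c g) {j : ℕ} (hj : j < n) :
    depth lam c g j ≤ g j * (lam (j + 1) - lam j) := by
  have := h.above j hj
  unfold depth
  linarith

theorem lam_lt (h : NewtonSeq n lam c g) {j : ℕ} (hj : j < n) : lam j < lam (j + 1) := by
  have h1 := (h.depth_nonneg hj.le).trans (h.depth_le hj)
  have h2 := nonneg_of_mul_nonneg_right h1 (h.slope_pos j hj.le)
  refine lt_of_le_of_ne (by linarith) fun he => ?_
  have h3 := h.improves j hj
  have h4 := h.lowest (j + 1) j (Nat.le_succ j) hj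
  rw [he] at h4
  linarith

theorem lam_le (h : NewtonSeq n lam c g) {i j : ℕ} (hij : j ≤ i) (hi : i ≤ n) :
    lam j ≤ lam i := by
  induction i, hij using Nat.le_induction with
  | base => exact le_rfl
  | succ i hij ih => exact (ih (by omega)).trans (h.lam_lt (by omega)).le

theorem slope_mul_le (h : NewtonSeq n lam c g) {i j : ℕ} (hij : j ≤ i) (hi : i ≤ n) :
    g i * (lam i - lam j) ≤ depth lam c g j - depth lam c g i := by
  have := h.lowest i j hij hi
  unfold depth
  linarith

theorem depth_succ_lt (h : NewtonSeq n lam c g) {j : ℕ} (hj : j < n) :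
    depth lam c g (j + 1) < depth lam c g j := by
  have h1 := h.slope_mul_le (Nat.le_succ j) hj
  have h2 := mul_pos (h.slope_pos (j + 1) hj) (sub_pos.2 (h.lam_lt hj))
  simp only [Nat.succ_eq_add_one] at h1
  linarith

/-- The Newton inequality: depth and slope cannot both stay large, the two ratios of consecutive
values add up to at most one. -/
theorem slope_mul_depth_le (h : NewtonSeq n lam c g) {j : ℕ} (hj : j < n) :
    g (j + 1) * depth lam c g j ≤ g j * (depth lam c g j - depth lam c g (j + 1)) := by
  have h1 := h.slope_mul_le (Nat.le_succ j) hj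
  have h2 := mul_le_mul_of_nonneg_left (h.depth_le hj) (h.slope_pos (j + 1) hj).le
  have h3 := mul_le_mul_of_nonneg_left h1 (h.slope_pos j hj.le).le
  simp only [Nat.succ_eq_add_one] at h3
  calc g (j + 1) * depth lam c g j ≤ g (j + 1) * (g j * (lam (j + 1) - lam j)) := h2
    _ = g j * (g (j + 1) * (lam (j + 1) - lam j)) := by ring
    _ ≤ _ := h3

theorem slope_succ_le (h : NewtonSeq n lam c g) {j : ℕ} (hj : j < n) : g (j + 1) ≤ g j := by
  have h1 := h.slope_mul_depth_le hj
  have h2 := h.depth_succ_lt hj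
  have h3 := h.depth_nonneg (Nat.succ_le_of_lt hj)
  have h4 := mul_nonneg (h.slope_pos j hj.le).le h3
  simp only [Nat.succ_eq_add_one] at h3 h4
  refine le_of_mul_le_mul_right (a := depth lam c g j) ?_ (by linarith)
  linarith

theorem slope_le (h : NewtonSeq n lam c g) {i j : ℕ} (hij : j ≤ i) (hi : i ≤ n) : g i ≤ g j := by
  induction i, hij using Nat.le_induction with
  | base => exact le_rfl
  | succ i hij ih => exact (h.slope_succ_le (by omega)).trans (ih (by omega))

/-- Where the slopes vary by a factor of at most two, the values of the lines at one fixed, later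
multiplier interlace with the depths.  These values belong to one and the same linear form. -/
theorem value_le_depth (h : NewtonSeq n lam c g) {j k : ℕ} (hjk : j ≤ k) (hk : k ≤ n)
    (hg : g j ≤ 2 * g k) : c j + lam k * g j ≤ depth lam c g j := by
  have h1 := h.slope_mul_le hjk hk
  have h2 := h.depth_nonneg hk
  have h3 := mul_le_mul_of_nonneg_right hg (sub_nonneg.2 (h.lam_le hjk hk))
  unfold depth at h1 h2 ⊢
  linarith

theorem depth_succ_le_value (h : NewtonSeq n lam c g) {j k : ℕ} (hjk : j + 2 ≤ k) (hk : k ≤ n) :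
    depth lam c g (j + 1) ≤ c j + lam k * g j := by
  have h1 := h.above j (by omega)
  have h2 := h.depth_le (j := j + 1) (by omega)
  have h3 : lam (j + 1 + 1) ≤ lam k := h.lam_le (by omega) hk
  have h4 := h.slope_succ_le (j := j) (by omega)
  have h5 := mul_le_mul_of_nonneg_right h4 (sub_pos.2 (h.lam_lt (j := j + 1) (by omega))).le
  have h6 := mul_le_mul_of_nonneg_left h3 (h.slope_pos j (by omega)).le
  linarith

theorem value_pos (h : NewtonSeq n lam c g) {j k : ℕ} (hjk : j + 2 ≤ k) (hk : k ≤ n) :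
    0 < c j + lam k * g j := by
  have h1 := h.above j (by omega)
  have h2 := h.lam_lt (j := j + 1) (by omega)
  have h3 : lam (j + 1 + 1) ≤ lam k := h.lam_le (by omega) hk
  have h4 := mul_pos (h.slope_pos j (by omega)) (sub_pos.2 (h2.trans_le h3))
  linarith

variable {ι : Type*} [Fintype ι] {p : ℕ} {u w : ι → ℝ} {y : ℕ → ι → ℕ}

/-- The slope is halved within any `O(p)` consecutive Newton steps.  Otherwise most steps reduce the
slope by very little only, hence by the Newton inequality they divide the depth by more than `2 p`;
but the depths interlace with the values of a linear form on zero-one vectors. -/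
theorem two_mul_slope_lt (hp : Fintype.card ι = p) (hp0 : 0 < p) (hy : ∀ i a, y i a ≤ 1)
    (h : NewtonSeq n lam (fun j => ∑ a, u a * y j a) fun j => ∑ a, w a * y j a) {s : ℕ}
    (hs : s + (8 * p + 6) ≤ n) : 2 * ∑ a, w a * y (s + (8 * p + 6)) a ≤ ∑ a, w a * y s a := by
  classical
  set c : ℕ → ℝ := fun j => ∑ a, u a * y j a with hc
  set g : ℕ → ℝ := fun j => ∑ a, w a * y j a with hg
  by_contra! hcon
  set k := s + (8 * p + 6) with hk
  change g s < 2 * g k at hcon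
  have hgk : 0 < g k := h.slope_pos k hs
  set M := 2 * p + 1 with hM
  -- the steps that reduce the slope by more than the fraction `1 / M`
  set bad : Finset ℕ := (Finset.range (2 * M)).filter fun i =>
    (M : ℝ) * g (s + 2 * i + 2) < (M - 1) * g (s + 2 * i + 1) with hbad
  have hMpos : (0 : ℝ) < M := by rw [hM]; positivity
  have hbadcard : bad.card ≤ M := by
    have h1 : ∀ m, s + 2 * m ≤ n →
        ∑ i ∈ Finset.range m, (g (s + 2 * i + 1) - g (s + 2 * i + 2)) ≤ g s - g (s + 2 * m) := by
      intro m
      induction m with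
      | zero => simp
      | succ m ih =>
        intro hm
        rw [Finset.sum_range_succ]
        have h2 := ih (by omega)
        have h3 := h.slope_succ_le (j := s + 2 * m) (by omega)
        rw [show s + 2 * (m + 1) = s + 2 * m + 2 by ring]
        linarith
    have h2 := h1 (2 * M) (by omega)
    have h3 : (bad.card : ℝ) * (g k / M) ≤
        ∑ i ∈ Finset.range (2 * M), (g (s + 2 * i + 1) - g (s + 2 * i + 2)) := by
      rw [← nsmul_eq_mul, ← Finset.sum_const]
      refine (Finset.sum_le_sum (s := bad) fun i hi => ?_).trans
        (Finset.sum_le_sum_of_subset_of_nonneg (Finset.filter_subset _ _) fun i hi _ => ?_)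
      · rw [hbad, Finset.mem_filter, Finset.mem_range] at hi
        have h4 : g k ≤ g (s + 2 * i + 1) := h.slope_le (by omega) hs
        rw [div_le_iff₀ hMpos]
        linarith [hi.2]
      · rw [Finset.mem_range] at hi
        exact sub_nonneg.2 (h.slope_succ_le (j := s + 2 * i + 1) (by omega))
    have h4 : g k ≤ g (s + 2 * (2 * M)) := h.slope_le (by omega) hs
    have h5 : (bad.card : ℝ) * (g k / M) ≤ M * (g k / M) := by
      rw [mul_div_cancel₀ _ hMpos.ne']
      linarith
    exact_mod_cast le_of_mul_le_mul_right h5 (div_pos hgk hMpos)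
  -- `M` of the other steps
  obtain ⟨S, hS, hScard⟩ : ∃ S ⊆ Finset.range (2 * M) \ bad, S.card = M := by
    refine Finset.exists_subset_card_eq ?_
    have := Finset.le_card_sdiff bad (Finset.range (2 * M))
    rw [Finset.card_range] at this
    omega
  set X : ℕ → ℝ := fun i => c (s + 2 * i) + lam k * g (s + 2 * i) with hX
  have hXpos : ∀ i ≤ 2 * M, 0 < X i := fun i hi =>
    h.value_pos (by omega) hs
  have hXle : ∀ i ≤ 2 * M, X i ≤ depth lam c g (s + 2 * i) := fun i hi =>
    h.value_le_depth (by omega) hs ((h.slope_le (by omega) (by omega)).trans hcon.le)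
  have hXsucc : ∀ i < 2 * M, X (i + 1) ≤ X i := by
    intro i hi
    have h1 := h.depth_succ_le_value (j := s + 2 * i) (k := k) (by omega) hs
    have h2 := h.depth_succ_lt (j := s + 2 * i + 1) (by omega)
    exact (hXle (i + 1) hi).trans (h2.le.trans h1)
  have hXanti : ∀ i j, i ≤ j → j ≤ 2 * M → X j ≤ X i := by
    intro i j hij
    induction j, hij using Nat.le_induction with
    | base => exact fun _ => le_rfl
    | succ j hij ih => exact fun hj => (hXsucc j (by omega)).trans (ih (by omega))
  have hXgood : ∀ i ∈ S, M * X (i + 1) ≤ X i := by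
    intro i hi
    have hi' := Finset.mem_sdiff.1 (hS hi)
    have hi2 : i < 2 * M := Finset.mem_range.1 hi'.1
    have h0 : ((M : ℝ) - 1) * g (s + 2 * i + 1) ≤ M * g (s + 2 * i + 2) := by
      by_contra! hlt
      exact hi'.2 (Finset.mem_filter.2 ⟨hi'.1, hlt⟩)
    have h1 := h.depth_succ_le_value (j := s + 2 * i) (k := k) (by omega) hs
    have h2 := h.slope_mul_depth_le (j := s + 2 * i + 1) (by omega)
    have h3 := h.depth_nonneg (j := s + 2 * i + 1) (by omega)
    have h4 : M * depth lam c g (s + 2 * i + 2) ≤ depth lam c g (s + 2 * i + 1) := by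
      refine le_of_mul_le_mul_left (a := g (s + 2 * i + 1)) ?_ (h.slope_pos _ (by omega))
      have h5 := mul_le_mul_of_nonneg_right h0 h3
      have h6 := mul_le_mul_of_nonneg_left h2 hMpos.le
      simp only [show s + 2 * i + 1 + 1 = s + 2 * i + 2 from rfl] at h6
      linarith
    have h5 := mul_le_mul_of_nonneg_left (hXle (i + 1) hi2) hMpos.le
    exact h5.trans (h4.trans h1)
  -- the values at these steps contradict the bound for steep sequences
  have hSn : ∀ i : Fin M, S.orderEmbOfFin hScard i ∈ S := fun i => Finset.orderEmbOfFin_mem S hScard i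
  have hSlt : ∀ i ∈ S, i < 2 * M := fun i hi =>
    Finset.mem_range.1 (Finset.mem_sdiff.1 (hS hi)).1
  let t : ℕ → ℕ := fun i => if hi : i < M then S.orderEmbOfFin hScard ⟨i, hi⟩ else 0
  have ht : ∀ i (hi : i < M), t i = S.orderEmbOfFin hScard ⟨i, hi⟩ := fun i hi => dif_pos hi
  have hval : ∀ i, ∑ a, (u a + lam k * w a) * y (s + 2 * t i) a = X (t i) := by
    intro i
    simp only [hX, hc, hg, Finset.mul_sum, ← Finset.sum_add_distrib]
    exact Finset.sum_congr rfl fun a _ => by ring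
  refine not_steep hp hp0 (fun a => u a + lam k * w a) (fun i => y (s + 2 * t i))
    (fun i a => hy _ a) (fun i hi => ?_) (fun i hi => ?_)
  · rw [hval, ht i hi]
    exact hXpos _ (hSlt _ (hSn _)).le
  · rw [hval, hval, ht i (by omega), ht (i + 1) hi]
    refine le_trans ?_ (hXgood _ (hSn _))
    refine mul_le_mul_of_nonneg_left (hXanti _ _ ?_ (hSlt _ (hSn _)).le) hMpos.le
    exact (S.orderEmbOfFin hScard).strictMono (Fin.mk_lt_mk.2 (Nat.lt_succ_self i))

/-- The number of Newton steps is `O(p ^ 2 log p)`: the slope is halved in every `O(p)` steps, and it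
can be halved `O(p log p)` times only. -/
theorem length_lt (hp : Fintype.card ι = p) (hp0 : 0 < p) (hy : ∀ i a, y i a ≤ 1)
    (h : NewtonSeq n lam (fun j => ∑ a, u a * y j a) fun j => ∑ a, w a * y j a) :
    n < 4 * p * (Nat.log 2 p + 2) * (8 * p + 6) := by
  by_contra! hn
  have hle : ∀ i < 4 * p * (Nat.log 2 p + 2), i * (8 * p + 6) ≤ n := fun i hi =>
    (Nat.mul_le_mul_right _ hi.le).trans hn
  refine not_halving hp hp0 w (fun i => y (i * (8 * p + 6))) (fun i a => hy _ a)
    (fun i hi => h.slope_pos _ (hle i hi)) (fun i hi => ?_)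
  have e : (i + 1) * (8 * p + 6) = i * (8 * p + 6) + (8 * p + 6) := by ring
  have h1 := hle (i + 1) hi
  rw [e] at h1
  simp only [e]
  exact h.two_mul_slope_lt hp hp0 hy h1

end NewtonSeq

/-! ### The number of multipliers in the Lagrangian phase -/

/-- A bound for the number of Newton steps on vectors with `p` entries, counted from one. -/
def newtonBound (p : ℕ) : ℕ := 4 * p * (Nat.log 2 p + 2) * (8 * p + 6)

/-- The Lagrangian phase seen through the lines `c + lam * (w - B)`.  In round `i` the line `(cp i, wp i)`
above the budget and the line `(cm i, wm i)` within the budget meet at the multiplier `lam i`.  There the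
new line `(cq i, wq i)` is strictly lower, and the lowest among itself and the later new lines.  It
replaces the line on its side of the budget. -/
structure Rounds (n : ℕ) (B : ℝ) (cp wp cm wm cq wq lam : ℕ → ℝ) : Prop where
  plus : ∀ i ≤ n, B ≤ wp i
  minus : ∀ i ≤ n, wm i ≤ B
  meet : ∀ i ≤ n, cp i + lam i * (wp i - B) = cm i + lam i * (wm i - B)
  improves : ∀ i < n, cq i + lam i * (wq i - B) < cp i + lam i * (wp i - B)
  lowest : ∀ i j, i ≤ j → j < n → cq i + lam i * (wq i - B) ≤ cq j + lam i * (wq j - B)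
  step : ∀ i < n,
    (B < wq i ∧ cp (i + 1) = cq i ∧ wp (i + 1) = wq i ∧ cm (i + 1) = cm i ∧ wm (i + 1) = wm i) ∨
    (wq i < B ∧ cp (i + 1) = cp i ∧ wp (i + 1) = wp i ∧ cm (i + 1) = cq i ∧ wm (i + 1) = wq i)

namespace Rounds

variable {n : ℕ} {B : ℝ} {cp wp cm wm cq wq lam : ℕ → ℝ}

/-- The reflection of weights and multipliers exchanges the two sides of the budget. -/
theorem swap (h : Rounds n B cp wp cm wm cq wq lam) :
    Rounds n B cm (fun i => 2 * B - wm i) cp (fun i => 2 * B - wp i) cq (fun i => 2 * B - wq i)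
      (fun i => -lam i) where
  plus i hi := by have := h.minus i hi; linarith
  minus i hi := by have := h.plus i hi; linarith
  meet i hi := by have := h.meet i hi; linarith
  improves i hi := by have h1 := h.improves i hi; have h2 := h.meet i hi.le; linarith
  lowest i j hij hj := by have := h.lowest i j hij hj; linarith
  step i hi := by
    rcases h.step i hi with ⟨h1, h2, h3, h4, h5⟩ | ⟨h1, h2, h3, h4, h5⟩
    · exact Or.inr ⟨by linarith, h4, by rw [h5], h2, by rw [h3]⟩
    · exact Or.inl ⟨by linarith, h4, by rw [h5], h2, by rw [h3]⟩

theorem level_succ_le_of_plus (h : Rounds n B cp wp cm wm cq wq lam) {i : ℕ} (hi : i < n)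
    (hq : B < wq i) :
    cp (i + 1) + lam (i + 1) * (wp (i + 1) - B) ≤ cp i + lam i * (wp i - B) := by
  rcases h.step i hi with ⟨-, h2, h3, h4, h5⟩ | ⟨h1, -⟩
  · have e1 := h.meet i hi.le
    have e2 := h.meet (i + 1) hi
    have e3 := h.improves i hi
    have e4 := h.minus i hi.le
    rw [h2, h3, h4, h5] at e2
    have hle : lam i ≤ lam (i + 1) := by
      by_contra! hlt
      have := mul_pos (sub_pos.2 hlt) (sub_pos.2 (e4.trans_lt hq))
      linarith
    have := mul_nonneg (sub_nonneg.2 hle) (sub_nonneg.2 e4)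
    rw [h2, h3]
    linarith
  · exact absurd h1 hq.not_gt

/-- The level at which the two current lines meet does not increase. -/
theorem level_succ_le (h : Rounds n B cp wp cm wm cq wq lam) {i : ℕ} (hi : i < n) :
    cp (i + 1) + lam (i + 1) * (wp (i + 1) - B) ≤ cp i + lam i * (wp i - B) := by
  rcases h.step i hi with ⟨h1, -⟩ | ⟨h1, -⟩
  · exact h.level_succ_le_of_plus hi h1
  · have e1 := h.swap.level_succ_le_of_plus hi (by linarith)
    have e2 := h.meet i hi.le
    have e3 := h.meet (i + 1) hi
    linarith

theorem level_le (h : Rounds n B cp wp cm wm cq wq lam) {i j : ℕ} (hij : i ≤ j) (hj : j ≤ n) :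
    cp j + lam j * (wp j - B) ≤ cp i + lam i * (wp i - B) := by
  induction j, hij using Nat.le_induction with
  | base => exact le_rfl
  | succ j hij ih => exact (h.level_succ_le (by omega)).trans (ih (by omega))

/-- The value of a new line at its multiplier is at most every later level, since it is at most the
values of the two lines that meet there. -/
theorem le_level (h : Rounds n B cp wp cm wm cq wq lam) {i j : ℕ} (hij : i ≤ j) (hi : i < n)
    (hj : j ≤ n) : cq i + lam i * (wq i - B) ≤ cp j + lam j * (wp j - B) := by
  have key : cq i + lam i * (wq i - B) ≤ cp j + lam i * (wp j - B) ∧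
      cq i + lam i * (wq i - B) ≤ cm j + lam i * (wm j - B) := by
    induction j, hij using Nat.le_induction with
    | base => exact ⟨(h.improves i hi).le, h.meet i hi.le ▸ (h.improves i hi).le⟩
    | succ j hij ih =>
      have h0 := h.lowest i j hij (by omega)
      obtain ⟨ih1, ih2⟩ := ih (by omega)
      rcases h.step j (by omega) with ⟨h1, h2, h3, h4, h5⟩ | ⟨h1, h2, h3, h4, h5⟩
      · rw [h2, h3, h4, h5]
        exact ⟨h0, ih2⟩
      · rw [h2, h3, h4, h5]
        exact ⟨ih1, h0⟩
  have e1 := h.plus j hj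
  have e2 := h.minus j hj
  have e3 := h.meet j hj
  rcases le_total (lam i) (lam j) with hle | hle
  · have := mul_nonneg (sub_nonneg.2 hle) (sub_nonneg.2 e1)
    linarith [key.1]
  · have := mul_nonneg (sub_nonneg.2 hle) (sub_nonneg.2 e2)
    linarith [key.2]

/-- The new lines above the budget form a sequence of Newton steps, whose level is that at which the
two lines meet in the end. -/
theorem card_plus_le (h : Rounds n B cp wp cm wm cq wq lam) {ι : Type*} [Fintype ι] {u w : ι → ℝ}
    {e : ℝ} {y : ℕ → ι → ℕ} (hy : ∀ i a, y i a ≤ 1) (hc : ∀ i < n, cq i = ∑ a, u a * y i a)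
    (hw : ∀ i < n, wq i = e + ∑ a, w a * y i a) :
    ((Finset.range n).filter fun i => B < wq i).card ≤ newtonBound (Fintype.card ι + 1) := by
  classical
  set T := (Finset.range n).filter fun i => B < wq i with hT
  set p : ℕ → Prop := fun i => i < n ∧ B < wq i with hp
  have hfin : (Set.ofPred p).Finite := (Set.finite_lt_nat n).subset fun i hi => hi.1
  have hcard : hfin.toFinset.card = T.card := by
    congr 1
    ext i
    rw [Set.Finite.mem_toFinset, hT, Finset.mem_filter, Finset.mem_range]
    exact Iff.rfl
  by_contra! hlt
  obtain ⟨m, hm⟩ : ∃ m, T.card = m + 1 := ⟨T.card - 1, by omega⟩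
  rw [hm] at hcard
  set s : ℕ → ℕ := Nat.nth p with hs
  have hsp : ∀ j ≤ m, s j < n ∧ B < wq (s j) := fun j hj =>
    Nat.nth_mem_of_lt_card hfin (by rw [hcard]; omega)
  have hsmono : ∀ i j, i < j → j ≤ m → s i < s j := fun i j hij hj =>
    Nat.nth_lt_nth_of_lt_card hfin hij (by rw [hcard]; omega)
  -- between two such rounds the line above the budget stays the same
  have hkeep : ∀ j < m, cp (s (j + 1)) = cq (s j) ∧ wp (s (j + 1)) = wq (s j) := by
    intro j hj
    have h1 : ∀ k, s j + 1 ≤ k → k ≤ s (j + 1) → cp k = cq (s j) ∧ wp k = wq (s j) := by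
      intro k hk
      induction k, hk using Nat.le_induction with
      | base =>
        intro _
        rcases h.step _ (hsp j hj.le).1 with ⟨-, h2, h3, -⟩ | ⟨h2, -⟩
        · exact ⟨h2, h3⟩
        · exact absurd h2 (hsp j hj.le).2.not_gt
      | succ k hk ih =>
        intro hk'
        have hkn : k < n := by have := (hsp (j + 1) hj).1; omega
        rcases h.step k hkn with ⟨h2, -⟩ | ⟨-, h2, h3, -⟩
        · have hk2 : k < s (j + 1) := by omega
          have hk3 : k ≤ s j := Nat.le_nth_of_lt_nth_succ (p := p) hk2 ⟨hkn, h2⟩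
          omega
        · rw [h2, h3]
          exact ih (by omega)
    exact h1 _ (hsmono j (j + 1) (by omega) hj) le_rfl
  set F := cp n + lam n * (wp n - B) with hF
  have hnewton : NewtonSeq m (fun j => lam (s j)) (fun j => cq (s j) - F) fun j => wq (s j) - B := by
    refine ⟨fun j hj => sub_pos.2 (hsp j hj).2, fun j hj => ?_, fun j hj => ?_, fun j hj => ?_,
      fun i j hij hi => ?_⟩
    · have := h.le_level (hsp j hj).1.le (hsp j hj).1 le_rfl
      linarith
    · have h1 := h.level_le (hsp (j + 1) hj).1.le le_rfl
      rw [(hkeep j hj).1, (hkeep j hj).2] at h1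
      linarith
    · have h1 := h.improves _ (hsp (j + 1) hj).1
      rw [(hkeep j hj).1, (hkeep j hj).2] at h1
      linarith
    · have hle : s j ≤ s i := by
        rcases hij.eq_or_lt with rfl | hlt
        · exact le_rfl
        · exact (hsmono j i hlt hi).le
      have := h.lowest _ _ hle (hsp i hi).1
      linarith
  -- the constant terms become the coefficients of an additional coordinate
  let y' : ℕ → Option ι → ℕ := fun j a => a.elim 1 fun a => y (s j) a
  let u' : Option ι → ℝ := fun a => a.elim (-F) u
  let w' : Option ι → ℝ := fun a => a.elim (e - B) w
  have hnewton' : NewtonSeq m (fun j => lam (s j)) (fun j => ∑ a, u' a * y' j a)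
      fun j => ∑ a, w' a * y' j a := by
    have e1 : ∀ j ≤ m, ∑ a, u' a * y' j a = cq (s j) - F := by
      intro j hj
      rw [Fintype.sum_option, hc _ (hsp j hj).1]
      simp only [u', y', Option.elim, Nat.cast_one, mul_one]
      ring
    have e2 : ∀ j ≤ m, ∑ a, w' a * y' j a = wq (s j) - B := by
      intro j hj
      rw [Fintype.sum_option, hw _ (hsp j hj).1]
      simp only [w', y', Option.elim, Nat.cast_one, mul_one]
      ring
    refine ⟨fun j hj => ?_, fun j hj => ?_, fun j hj => ?_, fun j hj => ?_, fun i j hij hi => ?_⟩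
    · rw [e2 j hj]
      exact hnewton.slope_pos j hj
    · simp only [e1 j hj, e2 j hj]
      exact hnewton.below j hj
    · simp only [e1 j hj.le, e2 j hj.le]
      exact hnewton.above j hj
    · simp only [e1 j hj.le, e2 j hj.le, e1 (j + 1) hj, e2 (j + 1) hj]
      exact hnewton.improves j hj
    · simp only [e1 i hi, e2 i hi, e1 j (hij.trans hi), e2 j (hij.trans hi)]
      exact hnewton.lowest i j hij hi
  have hlen := hnewton'.length_lt (p := Fintype.card ι + 1) Fintype.card_option (Nat.succ_pos _)
    (by
      rintro i (_ | a)
      · exact le_rfl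
      · exact hy _ a)
  unfold newtonBound at hlt
  omega

/-- The number of rounds is `O(p ^ 2 log p)`, if costs and weights are linear forms on zero-one vectors
with `p` entries. -/
theorem length_le (h : Rounds n B cp wp cm wm cq wq lam) {ι : Type*} [Fintype ι] {u w : ι → ℝ}
    {y : ℕ → ι → ℕ} (hy : ∀ i a, y i a ≤ 1) (hc : ∀ i < n, cq i = ∑ a, u a * y i a)
    (hw : ∀ i < n, wq i = ∑ a, w a * y i a) : n ≤ 2 * newtonBound (Fintype.card ι + 1) := by
  classical
  have h1 := h.card_plus_le (e := 0) hy hc fun i hi => by rw [hw i hi, zero_add]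
  have h2 := h.swap.card_plus_le (e := 2 * B) (w := fun a => -w a) hy hc fun i hi => by
    simp only [hw i hi, neg_mul, Finset.sum_neg_distrib]
    ring
  have h3 : Finset.range n ⊆ ((Finset.range n).filter fun i => B < wq i) ∪
      ((Finset.range n).filter fun i => B < 2 * B - wq i) := by
    intro i hi
    have hi' := Finset.mem_range.1 hi
    rw [Finset.mem_union, Finset.mem_filter, Finset.mem_filter]
    rcases h.step i hi' with ⟨h4, -⟩ | ⟨h4, -⟩
    · exact Or.inl ⟨hi, h4⟩
    · exact Or.inr ⟨hi, by linarith⟩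
  have h4 := (Finset.card_le_card h3).trans (Finset.card_union_le _ _)
  rw [Finset.card_range] at h4
  omega

end Rounds

/-! ### Feasible walks and the incumbent -/

namespace Network

variable {V : Type} [DecidableEq V]

/-- The graph with all its vertices. -/
abbrev full (V : Type) : V → Bool := fun _ => true

/-- The walk `o` is a feasible walk of least cost, and no vertex of it has been eliminated. -/
structure KeepsOptimal (N : Network V) (alive : V → Bool) (o : List V) : Prop where
  walk : N.IsWalk alive N.src N.dst o
  feasible : walkLen N.weight o ≤ N.budget
  least : ∀ l, N.IsWalk (full V) N.src N.dst l → walkLen N.weight l ≤ N.budget →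
    walkLen N.cost o ≤ walkLen N.cost l

/-- The route `q` may serve as incumbent: it respects the budget. -/
structure Incumbent (N : Network V) (q : Route V) : Prop where
  route : N.IsRoute (full V) q
  feasible : q.weight ≤ N.budget

/-- What it means for an outcome to be correct, in terms of walks given as lists. -/
def Correct (N : Network V) : Outcome V → Prop
  | Outcome.infeasible =>
      ∀ l, N.IsWalk (full V) N.src N.dst l → ¬ walkLen N.weight l ≤ N.budget
  | Outcome.optimal l => l.Nodup ∧ N.KeepsOptimal (full V) l
  | Outcome.bestFeasible l lower =>
      l.Nodup ∧ N.IsWalk (full V) N.src N.dst l ∧ walkLen N.weight l ≤ N.budget ∧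
        (∀ k, N.IsWalk (full V) N.src N.dst k → walkLen N.weight k ≤ N.budget →
          lower ≤ walkLen N.cost k) ∧
        ∀ μ : ℝ, 0 ≤ μ → ∃ k : List V, k.Nodup ∧ N.IsWalk (full V) N.src N.dst k ∧
          walkLen N.cost k + μ * (walkLen N.weight k - N.budget) ≤ lower

section

variable {N : Network V} {alive : V → Bool}

theorem IsWalk.to_full {u w : V} {l : List V} (h : N.IsWalk alive u w l) :
    N.IsWalk (full V) u w l :=
  h.mono fun _ _ => rfl

theorem IsRoute.to_full {q : Route V} (h : N.IsRoute alive q) : N.IsRoute (full V) q :=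
  ⟨h.walk.to_full, h.cost, h.weight, h.length_le⟩

theorem IsWalk.src_mem {w : V} {l : List V} {u : V} (h : N.IsWalk alive u w l) : u ∈ l :=
  List.mem_of_mem_head? h.head

theorem IsWalk.eliminate {u w v : V} {l : List V} (h : N.IsWalk alive u w l) (hv : v ∉ l) :
    N.IsWalk (Function.update alive v false) u w l :=
  ⟨h.head, h.last, fun x hx => by
    rw [Function.update_of_ne (by rintro rfl; exact hv hx)]
    exact h.present x hx, h.chain⟩

theorem KeepsOptimal.eliminate {o : List V} {v : V} (h : N.KeepsOptimal alive o) (hv : v ∉ o) :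
    N.KeepsOptimal (Function.update alive v false) o :=
  ⟨h.walk.eliminate hv, h.feasible, h.least⟩

theorem KeepsOptimal.le_incumbent {o : List V} (h : N.KeepsOptimal alive o) {q : Route V}
    (hq : N.Incumbent q) : walkLen N.cost o ≤ q.cost := by
  rw [hq.route.cost]
  exact h.least _ hq.route.walk (hq.route.weight ▸ hq.feasible)

theorem update_false_le (alive : V → Bool) (v : V) :
    ∀ x, Function.update alive v false x = true → alive x = true := by
  intro x hx
  by_cases hxv : x = v
  · subst hxv; simp at hx
  · rwa [Function.update_of_ne hxv] at hx

theorem cost_nonneg_of_regular (hN : N.Regular) : ∀ a b, b ∈ N.nbrs a → 0 ≤ N.cost a b :=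
  fun a b h => (hN.cost_pos a b h).le

/-- A bound for the time in which the closed detours are cut out of a route. -/
def eraseTime (n : ℕ) : ℕ := (2 * n + 1) * (2 * n + 2)

theorem Shortcut.isWalk {u w : V} {l l' : List V} (h : N.Shortcut l l')
    (hl : N.IsWalk alive u w l) : N.IsWalk alive u w l' :=
  ⟨h.head.trans hl.head, h.last.trans hl.last, fun x hx => hl.present x (h.subset x hx), h.chain⟩

theorem ens_eraseLoops_route (hN : N.Regular) {q : Route V} (hq : N.IsRoute alive q) :
    (eraseLoops q.verts).Ens fun l n => n ≤ eraseTime N.verts.length ∧ l.Nodup ∧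
      N.IsWalk alive N.src N.dst l ∧ walkLen N.cost l ≤ q.cost ∧
      walkLen N.weight l ≤ q.weight := by
  refine (ens_eraseLoops q.verts hq.walk.chain).mono ?_
  rintro l n ⟨hn, hl⟩
  refine ⟨hn.trans ?_, hl.nodup, hl.isWalk hq.walk, ?_, ?_⟩
  · have := hq.length_le
    unfold eraseTime
    gcongr
  · rw [hq.cost]
    exact hl.le _ (cost_nonneg_of_regular hN)
  · rw [hq.weight]
    exact hl.le _ fun a b _ => hN.weight_nonneg a b

theorem exists_nodup_walk (hN : N.Regular) {l : List V} (hl : N.IsWalk alive N.src N.dst l) :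
    ∃ k : List V, k.Nodup ∧ N.IsWalk alive N.src N.dst k ∧ walkLen N.cost k ≤ walkLen N.cost l ∧
      walkLen N.weight k ≤ walkLen N.weight l := by
  obtain ⟨k, n, -, -, hk⟩ := ens_eraseLoops l hl.chain
  exact ⟨k, hk.nodup, hk.isWalk hl, hk.le _ (cost_nonneg_of_regular hN),
    hk.le _ fun a b _ => hN.weight_nonneg a b⟩

/-- If there is a feasible walk, then there is one of least cost, as only the finitely many walks that
repeat no vertex matter. -/
theorem exists_keepsOptimal (hN : N.Regular) {l : List V}
    (hl : N.IsWalk (full V) N.src N.dst l) (hw : walkLen N.weight l ≤ N.budget) :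
    ∃ o, N.KeepsOptimal (full V) o := by
  set S : Set (List V) := {k | k.Nodup ∧ N.IsWalk (full V) N.src N.dst k ∧
    walkLen N.weight k ≤ N.budget} with hS
  have hfin : S.Finite := by
    refine ((N.verts.sublists.flatMap List.permutations).finite_toSet).subset ?_
    rintro k ⟨hk, hkw, -⟩
    obtain ⟨k', h1, h2⟩ := List.subperm_of_subset hk (hkw.mem_verts hN hN.src_mem)
    exact List.mem_flatMap.2 ⟨k', List.mem_sublists.2 h2, List.mem_permutations.2 h1.symm⟩
  have hne : S.Nonempty := by
    obtain ⟨k, h1, h2, -, h3⟩ := exists_nodup_walk hN hl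
    exact ⟨k, h1, h2, h3.trans hw⟩
  obtain ⟨o, ⟨-, ho1, ho2⟩, hmin⟩ := Set.exists_min_image S (walkLen N.cost) hfin hne
  refine ⟨o, ho1, ho2, fun k hk hkw => ?_⟩
  obtain ⟨k', h1, h2, h3, h4⟩ := exists_nodup_walk hN hk
  exact (hmin k' ⟨h1, h2, h4.trans hkw⟩).trans h3

theorem lenInf_pos (hN : N.Regular) : ∀ u w, w ∈ N.nbrs u → 0 < N.lenInf u w := by
  intro u w h
  refine Prod.Lex.lt_iff.2 ?_
  rcases (hN.weight_nonneg u w).lt_or_eq with h1 | h1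
  · exact Or.inl h1
  · exact Or.inr ⟨h1, hN.cost_pos u w h⟩

theorem lenAt_pos (hN : N.Regular) {lam : ℝ} (hlam : 0 ≤ lam) :
    ∀ u w, w ∈ N.nbrs u → 0 < N.lenAt lam u w := fun u w h =>
  add_pos_of_pos_of_nonneg (hN.cost_pos u w h) (mul_nonneg hlam (hN.weight_nonneg u w))

theorem lenInf_symm (hN : N.Regular) : ∀ u w, N.lenInf u w = N.lenInf w u := fun u w => by
  simp only [lenInf, hN.cost_symm u w, hN.weight_symm u w]

theorem lenAt_symm (hN : N.Regular) (lam : ℝ) : ∀ u w, N.lenAt lam u w = N.lenAt lam w u :=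
  fun u w => by simp only [lenAt, hN.cost_symm u w, hN.weight_symm u w]

theorem weight_le_of_lenInf_le {l k : List V} (h : walkLen N.lenInf l ≤ walkLen N.lenInf k) :
    walkLen N.weight l ≤ walkLen N.weight k := by
  rw [walkLen_lenInf, walkLen_lenInf] at h
  rcases Prod.Lex.le_iff.1 h with h | h
  · exact h.le
  · exact h.1.le

end

/-! ### The first phase -/

section

variable {N : Network V}

/-- The vertex `v` lies on some walk from source to target. -/
def Linked (N : Network V) (v : V) : Prop := ∃ l, N.IsWalk (full V) N.src N.dst l ∧ v ∈ l

/-- One vertex in the first phase: the least weight and the least cost of a walk through a vertex of an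
optimal walk never exclude that vertex. -/
theorem ens_cogrVertex (hN : N.Regular) {o : List V} {st : CogrState V} {v : V} (hv : v ∈ N.verts)
    (ho : N.KeepsOptimal st.alive o) (hb : N.Incumbent st.best) :
    (N.cogrVertex st v).Ens fun st' n => n ≤ 1 + 2 * routeTime N.verts.length ∧
      N.KeepsOptimal st'.alive o ∧ N.Incumbent st'.best ∧
      (∀ x, st'.alive x = true → st.alive x = true) ∧
      (st'.changed = true → st.changed = true ∨ (st.alive v = true ∧ st'.alive v = false)) ∧
      (st'.alive v = true → N.Linked v) := by
  unfold cogrVertex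
  refine ens_tick_bind ?_
  split_ifs with hva
  swap
  · exact ens_pure ⟨by omega, ho, hb, fun _ h => h, Or.inl, fun h => absurd h hva⟩
  refine ens_bind ((ens_routeThrough hN (lenInf_pos hN) (lenInf_symm hN) hva hv).mono ?_)
  rintro rInf n ⟨hn, hInf⟩
  refine ens_bind ((ens_routeThrough hN hN.cost_pos hN.cost_symm hva hv).mono ?_)
  rintro rZero m ⟨hm, hZero⟩
  have helim : v ∉ o → (pure ⟨Function.update st.alive v false, st.best, true⟩ :
      Comp (CogrState V)).Ens fun st' k =>
      1 + (n + (m + k)) ≤ 1 + 2 * routeTime N.verts.length ∧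
      N.KeepsOptimal st'.alive o ∧ N.Incumbent st'.best ∧
      (∀ x, st'.alive x = true → st.alive x = true) ∧
      (st'.changed = true → st.changed = true ∨ (st.alive v = true ∧ st'.alive v = false)) ∧
      (st'.alive v = true → N.Linked v) := fun hvo =>
    ens_pure ⟨by omega, ho.eliminate hvo, hb, update_false_le _ _,
      fun _ => Or.inr ⟨hva, Function.update_self _ _ _⟩, fun h => by simp at h⟩
  rcases rInf with _ | a
  · exact helim (hInf o ho.walk)
  rcases rZero with _ | b
  · exact helim (hZero o ho.walk)
  obtain ⟨ha1, ha2, -, ha3⟩ := hInf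
  obtain ⟨hb1, hb2, -, hb3⟩ := hZero
  have hkeep : ∀ U, N.Incumbent U → (pure ⟨st.alive, U, st.changed⟩ :
      Comp (CogrState V)).Ens fun st' k =>
      1 + (n + (m + k)) ≤ 1 + 2 * routeTime N.verts.length ∧
      N.KeepsOptimal st'.alive o ∧ N.Incumbent st'.best ∧
      (∀ x, st'.alive x = true → st.alive x = true) ∧
      (st'.changed = true → st.changed = true ∨ (st.alive v = true ∧ st'.alive v = false)) ∧
      (st'.alive v = true → N.Linked v) := fun U hU =>
    ens_pure ⟨by omega, ho, hU, fun _ h => h, Or.inl, fun _ => ⟨a.verts, ha1.walk.to_full, ha2⟩⟩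
  simp only
  split_ifs with hcond h1 h2 h2
  · refine helim fun hvo => ?_
    have h1 := weight_le_of_lenInf_le (ha3 o ho.walk hvo)
    have h2 := hb3 o ho.walk hvo
    rw [← ha1.weight] at h1
    rw [← hb1.cost] at h2
    rcases hcond with h | h
    · exact absurd (h1.trans ho.feasible) h.not_ge
    · exact absurd (h2.trans (ho.le_incumbent hb)) h.not_ge
  · exact hkeep b ⟨hb1.to_full, h2.2⟩
  · exact hkeep a ⟨ha1.to_full, not_lt.1 (not_or.1 hcond).1⟩
  · exact hkeep b ⟨hb1.to_full, h2.2⟩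
  · exact hkeep _ hb

/-- A bound for the time of one scan of the first phase on `n` vertices. -/
def cogrScanTime (n : ℕ) : ℕ := n * (1 + 2 * routeTime n)

theorem ens_cogrScan (hN : N.Regular) {o : List V} {alive : V → Bool} {best : Route V}
    (ho : N.KeepsOptimal alive o) (hb : N.Incumbent best) :
    (N.verts.foldlM N.cogrVertex ⟨alive, best, false⟩).Ens fun st n =>
      n ≤ cogrScanTime N.verts.length ∧ N.KeepsOptimal st.alive o ∧ N.Incumbent st.best ∧
      (∀ x, st.alive x = true → alive x = true) ∧
      (st.changed = true → ∃ v ∈ N.verts, alive v = true ∧ st.alive v = false) ∧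
      (∀ v ∈ N.verts, st.alive v = true → N.Linked v) := by
  refine (ens_foldlM (fun l st => (∀ x ∈ l, x ∈ N.verts) ∧ N.KeepsOptimal st.alive o ∧
      N.Incumbent st.best ∧ (∀ x, st.alive x = true → alive x = true) ∧
      (st.changed = true → ∃ v ∈ N.verts, alive v = true ∧ st.alive v = false) ∧
      (∀ v ∈ N.verts, v ∈ l ∨ (st.alive v = true → N.Linked v)))
    (1 + 2 * routeTime N.verts.length) ?_ N.verts _
    ⟨fun _ h => h, ho, hb, fun _ h => h, fun h => by simp at h, fun v hv => Or.inl hv⟩).mono ?_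
  · rintro v l st ⟨hl, h1, h2, h3, h4, h5⟩
    have hv := hl v (by simp)
    refine (ens_cogrVertex hN hv h1 h2).mono ?_
    rintro st' n ⟨hn, h1', h2', h3', h4', h5'⟩
    refine ⟨hn, fun x hx => hl x (List.mem_cons_of_mem _ hx), h1', h2', fun x hx => h3 x (h3' x hx),
      fun hc => ?_, fun x hx => ?_⟩
    · rcases h4' hc with h | h
      · obtain ⟨x, hx1, hx2, hx3⟩ := h4 h
        refine ⟨x, hx1, hx2, ?_⟩
        by_contra hne
        rw [Bool.not_eq_false] at hne
        rw [h3' x hne] at hx3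
        cases hx3
      · exact ⟨v, hv, h3 v h.1, h.2⟩
    · rcases h5 x hx with h | h
      · rcases List.mem_cons.1 h with rfl | h
        · exact Or.inr h5'
        · exact Or.inl h
      · exact Or.inr fun hx' => h (h3' x hx')
  · rintro st n ⟨hn, -, h1, h2, h3, h4, h5⟩
    exact ⟨hn, h1, h2, h3, h4, fun v hv => (h5 v hv).resolve_left (by simp)⟩

open Classical in
/-- The number of scans that remain in the first phase.  The first scan eliminates all vertices that
are not linked, and each later scan but the last one eliminates a linked vertex. -/
noncomputable def scansLeft (N : Network V) (alive : V → Bool) : ℕ :=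
  (N.verts.toFinset.filter fun v => alive v = true ∧ N.Linked v).card +
    if ∀ v ∈ N.verts, alive v = true → N.Linked v then 1 else 2

theorem scansLeft_lt {alive alive' : V → Bool} (hle : ∀ x, alive' x = true → alive x = true)
    (hlink : ∀ v ∈ N.verts, alive' v = true → N.Linked v)
    (hex : ∃ v ∈ N.verts, alive v = true ∧ alive' v = false) :
    N.scansLeft alive' + 1 ≤ N.scansLeft alive := by
  classical
  unfold scansLeft
  rw [if_pos hlink]
  have hsub : (N.verts.toFinset.filter fun v => alive' v = true ∧ N.Linked v) ⊆
      N.verts.toFinset.filter fun v => alive v = true ∧ N.Linked v :=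
    Finset.monotone_filter_right _ fun v _ h => ⟨hle v h.1, h.2⟩
  split_ifs with h
  · obtain ⟨v, hv, h1, h2⟩ := hex
    have := Finset.card_lt_card ((Finset.ssubset_iff_of_subset hsub).2
      ⟨v, by simp [hv, h1, h v hv h1], by simp [h2]⟩)
    omega
  · have := Finset.card_le_card hsub
    omega

theorem ens_cogr (hN : N.Regular) {o : List V} {alive : V → Bool} {best : Route V}
    (ho : N.KeepsOptimal alive o) (hb : N.Incumbent best) :
    (N.cogr alive best).Ens fun r n => (N.KeepsOptimal r.1 o ∧ N.Incumbent r.2) ∧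
      n ≤ N.scansLeft alive * (cogrScanTime N.verts.length + 1) := by
  unfold cogr
  refine ens_loop (γ := Unit) (fun _ (st : (V → Bool) × Route V) => N.KeepsOptimal st.1 o ∧ N.Incumbent st.2)
    (fun _ st => N.scansLeft st.1 * (cogrScanTime N.verts.length + 1))
    (fun (r : (V → Bool) × Route V) => N.KeepsOptimal r.1 o ∧ N.Incumbent r.2) ?_ (g := ()) ⟨ho, hb⟩
  rintro - ⟨alive, best⟩ ⟨ho, hb⟩
  refine ens_bind ((ens_cogrScan hN ho hb).mono ?_)
  rintro st n ⟨hn, h1, h2, h3, h4, h5⟩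
  split_ifs with hc
  · refine ens_pure (Or.inl ⟨_, rfl, (), ⟨h1, h2⟩, ?_⟩)
    have : (N.scansLeft st.alive + 1) * (cogrScanTime N.verts.length + 1) ≤
        N.scansLeft alive * (cogrScanTime N.verts.length + 1) :=
      Nat.mul_le_mul_right _ (scansLeft_lt h3 h5 (h4 hc))
    rw [Nat.add_mul] at this
    change n + 0 + 1 + N.scansLeft st.alive * (cogrScanTime N.verts.length + 1) ≤
      N.scansLeft alive * (cogrScanTime N.verts.length + 1)
    omega
  · refine ens_pure (Or.inr ⟨_, rfl, ⟨h1, h2⟩, ?_⟩)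
    have h6 : 1 ≤ N.scansLeft alive := by
      unfold scansLeft
      split_ifs <;> omega
    have := Nat.mul_le_mul_right (cogrScanTime N.verts.length + 1) h6
    change n + 0 + 1 ≤ N.scansLeft alive * (cogrScanTime N.verts.length + 1)
    omega

end

end Network

/-! ### The second phase -/

namespace Network

variable {V : Type} [DecidableEq V] {N : Network V}

theorem dualValue_eq {alive : V → Bool} {q : Route V} (hq : N.IsRoute alive q) (lam : ℝ) :
    N.dualValue lam q = walkLen (N.lenAt lam) q.verts - lam * N.budget := by
  rw [dualValue, walkLen_lenAt, hq.cost, hq.weight]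
  ring

/-- Weak duality: the Lagrangian value of a feasible walk is at most its cost. -/
theorem lenAt_le_of_feasible {lam : ℝ} (hlam : 0 ≤ lam) {l : List V}
    (hl : walkLen N.weight l ≤ N.budget) :
    walkLen (N.lenAt lam) l - lam * N.budget ≤ walkLen N.cost l := by
  have := mul_le_mul_of_nonneg_left hl hlam
  rw [walkLen_lenAt]
  linarith

/-- The route `p` is shortest for the multiplier `lam` among the walks through present vertices. -/
structure ShortestAt (N : Network V) (alive : V → Bool) (lam : ℝ) (p : Route V) : Prop where
  route : N.IsRoute alive p
  least : ∀ l, N.IsWalk alive N.src N.dst l →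
    walkLen (N.lenAt lam) p.verts ≤ walkLen (N.lenAt lam) l

theorem ShortestAt.dualValue_le {alive : V → Bool} {lam : ℝ} {p : Route V}
    (h : N.ShortestAt alive lam p) (hlam : 0 ≤ lam) {o : List V} (ho : N.KeepsOptimal alive o) :
    N.dualValue lam p ≤ walkLen N.cost o := by
  rw [dualValue_eq h.route]
  linarith [h.least o ho.walk, lenAt_le_of_feasible hlam ho.feasible]

/-- A bound for the time of one scan of the second phase on `n` vertices. -/
def logrScanTime (n : ℕ) : ℕ := n * (1 + routeTime n)

/-- A scan of the second phase eliminates neither a vertex of an optimal walk nor one of the shortest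
route at the current multiplier, and the lower bound is the value of that route. -/
theorem ens_logrScan (hN : N.Regular) {o : List V} {alive : V → Bool} {best p : Route V} {lam : ℝ}
    (hlam : 0 ≤ lam) (ho : N.KeepsOptimal alive o) (hb : N.Incumbent best)
    (hp : N.ShortestAt alive lam p) :
    (N.verts.foldlM (N.logrVertex lam) ⟨alive, best, N.dualValue lam p⟩).Ens fun st n =>
      n ≤ logrScanTime N.verts.length ∧ N.KeepsOptimal st.alive o ∧ N.Incumbent st.best ∧
      (∀ x, st.alive x = true → alive x = true) ∧ N.IsWalk st.alive N.src N.dst p.verts ∧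
      st.lower = N.dualValue lam p := by
  refine (ens_foldlM (fun l st => (∀ x ∈ l, x ∈ N.verts) ∧ N.KeepsOptimal st.alive o ∧
      N.Incumbent st.best ∧ (∀ x, st.alive x = true → alive x = true) ∧
      N.IsWalk st.alive N.src N.dst p.verts ∧ st.lower = N.dualValue lam p)
    (1 + routeTime N.verts.length) ?_ N.verts _
    ⟨fun _ h => h, ho, hb, fun _ h => h, hp.route.walk, rfl⟩).mono
    fun st n h => ⟨h.1, h.2.2⟩
  rintro v l ⟨al, U, L⟩ ⟨hl, h1, h2, h3, h4, h5⟩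
  dsimp only at h1 h2 h3 h4 h5
  subst h5
  have hl' : ∀ x ∈ l, x ∈ N.verts := fun x hx => hl x (List.mem_cons_of_mem _ hx)
  unfold logrVertex
  refine ens_tick_bind ?_
  dsimp only
  split_ifs with hva
  swap
  · exact ens_pure ⟨by omega, hl', h1, h2, h3, h4, rfl⟩
  refine ens_bind ((ens_routeThrough hN (lenAt_pos hN hlam) (lenAt_symm hN lam) hva
    (hl v (by simp))).mono ?_)
  rintro r n ⟨hn, hr⟩
  have helim : v ∉ o → v ∉ p.verts → (pure ⟨Function.update al v false, U, N.dualValue lam p⟩ :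
      Comp (ScanState V)).Ens fun st k => 1 + (n + k) ≤ 1 + routeTime N.verts.length ∧
      (∀ x ∈ l, x ∈ N.verts) ∧ N.KeepsOptimal st.alive o ∧
      N.Incumbent st.best ∧ (∀ x, st.alive x = true → alive x = true) ∧
      N.IsWalk st.alive N.src N.dst p.verts ∧ st.lower = N.dualValue lam p := fun hvo hvp =>
    ens_pure ⟨by omega, hl', h1.eliminate hvo, h2, fun x hx => h3 x (update_false_le _ _ x hx),
      h4.eliminate hvp, rfl⟩
  rcases r with _ | q
  · exact helim (hr o h1.walk) (hr _ h4)
  obtain ⟨hq1, hq2, -, hq3⟩ := hr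
  have hmin : min (N.dualValue lam p) (N.dualValue lam q) = N.dualValue lam p := by
    rw [min_eq_left_iff, dualValue_eq hp.route, dualValue_eq hq1]
    linarith [hp.least _ (hq1.walk.mono h3)]
  simp only
  split_ifs with hc1 hc2
  · exact ens_pure ⟨by omega, hl', h1, ⟨hq1.to_full, hc1.2⟩, h3, h4, hmin⟩
  · have hval : N.dualValue lam p ≤ U.cost :=
      (hp.dualValue_le hlam ho).trans (h1.le_incumbent h2)
    rw [dualValue_eq hq1] at hc2
    refine helim (fun hvo => ?_) (fun hvp => ?_)
    · have e1 := hq3 o h1.walk hvo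
      have e2 := lenAt_le_of_feasible hlam h1.feasible
      have e3 := h1.le_incumbent h2
      linarith
    · have e1 := hq3 _ h4 hvp
      rw [dualValue_eq hp.route] at hval
      linarith
  · exact ens_pure ⟨by omega, hl', h1, h2, h3, h4, hmin⟩

/-- The multiplier at which the routes `p⁺` and `p⁻` have the same Lagrangian value. -/
noncomputable def multiplier (st : LogrState V) : ℝ :=
  (st.minus.cost - st.plus.cost) / (st.plus.weight - st.minus.weight)

/-- The invariant of the second phase.  The route `p⁺` was shortest at some multiplier when it was
found, and the route found last is still present. -/
structure LogrInv (N : Network V) (o : List V) (st : LogrState V) : Prop where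
  keeps : N.KeepsOptimal st.alive o
  incumbent : N.Incumbent st.best
  plus : N.IsRoute (full V) st.plus
  plus_weight : N.budget < st.plus.weight
  minus : N.IsRoute (full V) st.minus
  minus_weight : st.minus.weight ≤ N.budget
  cost_le : st.plus.cost ≤ st.minus.cost
  origin : ∃ lam, 0 ≤ lam ∧ ∀ l, N.IsWalk st.alive N.src N.dst l →
    st.plus.cost + lam * st.plus.weight ≤ walkLen N.cost l + lam * walkLen N.weight l
  newest : N.IsWalk st.alive N.src N.dst st.plus.verts ∨
    N.IsWalk st.alive N.src N.dst st.minus.verts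

/-- One round of the second phase that leads from `st` to `st'` by means of the route `p`. -/
structure LogrRound (N : Network V) (st : LogrState V) (p : Route V) (st' : LogrState V) :
    Prop where
  shortest : N.ShortestAt st.alive (multiplier st) p
  nodup : p.verts.Nodup
  improves : p.cost + multiplier st * p.weight < st.plus.cost + multiplier st * st.plus.weight
  mono : ∀ x, st'.alive x = true → st.alive x = true
  walk : N.IsWalk st'.alive N.src N.dst p.verts
  step : (N.budget < p.weight ∧ st'.plus = p ∧ st'.minus = st.minus) ∨
    (p.weight < N.budget ∧ st'.plus = st.plus ∧ st'.minus = p)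

theorem LogrInv.multiplier_nonneg {o : List V} {st : LogrState V} (h : N.LogrInv o st) :
    0 ≤ multiplier st :=
  div_nonneg (sub_nonneg.2 h.cost_le)
    (sub_nonneg.2 (h.minus_weight.trans h.plus_weight.le))

theorem LogrInv.meet {o : List V} {st : LogrState V} (h : N.LogrInv o st) :
    st.plus.cost + multiplier st * st.plus.weight =
      st.minus.cost + multiplier st * st.minus.weight := by
  have h1 : st.plus.weight - st.minus.weight ≠ 0 :=
    (sub_pos.2 (h.minus_weight.trans_lt h.plus_weight)).ne'
  have h2 : multiplier st * (st.plus.weight - st.minus.weight) = st.minus.cost - st.plus.cost :=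
    div_mul_cancel₀ _ h1
  linarith

theorem LogrInv.le_plus {o : List V} {st : LogrState V} (h : N.LogrInv o st) {p : Route V}
    (hp : N.ShortestAt st.alive (multiplier st) p) :
    p.cost + multiplier st * p.weight ≤ st.plus.cost + multiplier st * st.plus.weight := by
  have h1 := h.meet
  rcases h.newest with h2 | h2
  · have h3 := hp.least _ h2
    rw [walkLen_lenAt, walkLen_lenAt, ← hp.route.cost, ← hp.route.weight, ← h.plus.cost,
      ← h.plus.weight] at h3
    exact h3
  · have h3 := hp.least _ h2
    rw [walkLen_lenAt, walkLen_lenAt, ← hp.route.cost, ← hp.route.weight, ← h.minus.cost,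
      ← h.minus.weight] at h3
    rwa [h1]

theorem LogrInv.next {o : List V} {st st' : LogrState V} {p : Route V} (h : N.LogrInv o st)
    (hr : N.LogrRound st p st') (ho : N.KeepsOptimal st'.alive o) (hb : N.Incumbent st'.best) :
    N.LogrInv o st' := by
  have hlam := h.multiplier_nonneg
  have himp := hr.improves
  have hleast : ∀ l, N.IsWalk st.alive N.src N.dst l →
      p.cost + multiplier st * p.weight ≤ walkLen N.cost l + multiplier st * walkLen N.weight l := by
    intro l hl
    have := hr.shortest.least l hl
    rwa [walkLen_lenAt, walkLen_lenAt, ← hr.shortest.route.cost, ← hr.shortest.route.weight] at this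
  rcases hr.step with ⟨h1, h2, h3⟩ | ⟨h1, h2, h3⟩
  · refine ⟨ho, hb, h2 ▸ hr.shortest.route.to_full, h2 ▸ h1, h3 ▸ h.minus, h3 ▸ h.minus_weight, ?_,
      ⟨multiplier st, hlam, ?_⟩, Or.inl (h2 ▸ hr.walk)⟩
    · rw [h2, h3]
      rw [h.meet] at himp
      have := mul_le_mul_of_nonneg_left (h.minus_weight.trans h1.le) hlam
      linarith
    · intro l hl
      rw [h2]
      exact hleast l (hl.mono hr.mono)
  · obtain ⟨lam, hlam', hbase⟩ := h.origin
    refine ⟨ho, hb, h2 ▸ h.plus, h2 ▸ h.plus_weight, h3 ▸ hr.shortest.route.to_full, h3 ▸ h1.le, ?_,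
      ⟨lam, hlam', ?_⟩, Or.inr (h3 ▸ hr.walk)⟩
    · rw [h2, h3]
      have e1 := hbase _ hr.shortest.route.walk
      rw [← hr.shortest.route.cost, ← hr.shortest.route.weight] at e1
      have := mul_le_mul_of_nonneg_left (h1.trans h.plus_weight).le hlam'
      linarith
    · intro l hl
      rw [h2]
      exact hbase l (hl.mono hr.mono)

/-- A feasible route that costs no more than an optimal walk is optimal, also after its closed detours
have been cut out. -/
theorem ens_eraseLoops_optimal (hN : N.Regular) {alive : V → Bool} {o : List V} {q : Route V}
    (ho : N.KeepsOptimal alive o) (hq : N.IsRoute (full V) q) (hw : q.weight ≤ N.budget)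
    (hc : q.cost ≤ walkLen N.cost o) :
    (eraseLoops q.verts).Ens fun l n =>
      n ≤ eraseTime N.verts.length ∧ N.Correct (Outcome.optimal l) := by
  refine (ens_eraseLoops_route hN hq).mono ?_
  rintro l n ⟨hn, h1, h2, h3, h4⟩
  exact ⟨hn, h1, h2, h4.trans hw, fun k hk hkw => (h3.trans hc).trans (ho.least k hk hkw)⟩

/-- If `p` has the same value as `p⁺` and `p⁻` at the multiplier where these meet, then this value bounds
the dual function: by `p⁻` at larger multipliers and by `p⁺` at smaller ones. -/
theorem LogrInv.dual_le {o : List V} {st : LogrState V} (hN : N.Regular) (h : N.LogrInv o st)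
    {p : Route V} (hp : p.cost + multiplier st * p.weight =
      st.plus.cost + multiplier st * st.plus.weight) {μ : ℝ} (hμ : 0 ≤ μ) :
    ∃ k : List V, k.Nodup ∧ N.IsWalk (full V) N.src N.dst k ∧
      walkLen N.cost k + μ * (walkLen N.weight k - N.budget) ≤ N.dualValue (multiplier st) p := by
  have hmeet := h.meet
  have key : ∀ q : Route V, N.IsRoute (full V) q →
      q.cost + μ * (q.weight - N.budget) ≤ N.dualValue (multiplier st) p →
      ∃ k : List V, k.Nodup ∧ N.IsWalk (full V) N.src N.dst k ∧
        walkLen N.cost k + μ * (walkLen N.weight k - N.budget) ≤ N.dualValue (multiplier st) p := by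
    intro q hq hle
    obtain ⟨k, h1, h2, h3, h4⟩ := exists_nodup_walk hN hq.walk
    refine ⟨k, h1, h2, le_trans ?_ hle⟩
    rw [hq.cost, hq.weight]
    have := mul_le_mul_of_nonneg_left h4 hμ
    linarith
  unfold dualValue at key ⊢
  rcases le_total (multiplier st) μ with hle | hle
  · refine key st.minus h.minus ?_
    have := mul_nonneg (sub_nonneg.2 hle) (sub_nonneg.2 h.minus_weight)
    linarith
  · refine key st.plus h.plus ?_
    have := mul_nonneg (sub_nonneg.2 hle) (sub_nonneg.2 h.plus_weight.le)
    linarith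

/-- A bound for the time of one round of the second phase on `n` vertices. -/
def logrRoundTime (n : ℕ) : ℕ := routeTime n + logrScanTime n + eraseTime n

theorem ens_logrStep (hN : N.Regular) {o : List V} {st : LogrState V} (h : N.LogrInv o st) :
    (N.logrStep st).Ens fun r n => n ≤ logrRoundTime N.verts.length ∧
      ((∃ st', r = Sum.inl st' ∧ N.LogrInv o st' ∧ ∃ p, N.LogrRound st p st') ∨
        ∃ out, r = Sum.inr out ∧ N.Correct out) := by
  have hlam := h.multiplier_nonneg
  have hsrc : st.alive N.src = true := h.keeps.walk.present _ h.keeps.walk.src_mem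
  unfold logrStep
  refine ens_bind ((ens_routeThrough (len := N.lenAt (multiplier st)) hN (lenAt_pos hN hlam)
    (lenAt_symm hN _) hsrc hN.src_mem).mono ?_)
  rintro r n ⟨hn, hr⟩
  rcases r with _ | p
  · exact absurd h.keeps.walk.src_mem (hr o h.keeps.walk)
  obtain ⟨hp1, -, hp2, hp3⟩ := hr
  have hp : N.ShortestAt st.alive (multiplier st) p :=
    ⟨hp1, fun l hl => hp3 l hl hl.src_mem⟩
  have hpo := hp.dualValue_le hlam h.keeps
  change (if p.weight = N.budget then _ else _ : Comp (LogrState V ⊕ Outcome V)).Ens _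
  by_cases hpw : p.weight = N.budget
  · rw [if_pos hpw]
    refine ens_bind ((ens_eraseLoops_optimal hN h.keeps hp1.to_full hpw.le ?_).mono ?_)
    · rw [dualValue, hpw] at hpo
      linarith
    · rintro l m ⟨hm, hl⟩
      exact ens_pure ⟨by unfold logrRoundTime; omega, Or.inr ⟨_, rfl, hl⟩⟩
  rw [if_neg hpw]
  refine ens_bind ((ens_logrScan hN hlam h.keeps h.incumbent hp).mono ?_)
  rintro ⟨al, U, L⟩ m ⟨hm, h1, h2, h3, h4, h5⟩
  dsimp only at h1 h2 h3 h4 h5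
  subst h5
  change (if N.dualValue (multiplier st) p = U.cost then _ else
    if p.cost + multiplier st * p.weight = st.plus.cost + multiplier st * st.plus.weight ∨
      p.cost + multiplier st * p.weight = st.minus.cost + multiplier st * st.minus.weight then _ else
    if p.weight < N.budget then _ else _ : Comp (LogrState V ⊕ Outcome V)).Ens _
  split_ifs with hc1 hc2 hc3
  · refine ens_bind ((ens_eraseLoops_optimal hN h.keeps h2.route h2.feasible (hc1 ▸ hpo)).mono ?_)
    rintro l k ⟨hk, hl⟩
    exact ens_pure ⟨by unfold logrRoundTime; omega, Or.inr ⟨_, rfl, hl⟩⟩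
  · refine ens_bind ((ens_eraseLoops_route hN h2.route).mono ?_)
    rintro l k ⟨hk, hl1, hl2, hl3, hl4⟩
    refine ens_pure ⟨by unfold logrRoundTime; omega, Or.inr ⟨_, rfl, hl1, hl2,
      hl4.trans h2.feasible, fun j hj hjw => hpo.trans (h.keeps.least j hj hjw),
      fun μ hμ => h.dual_le hN ?_ hμ⟩⟩
    rcases hc2 with hc2 | hc2
    · exact hc2
    · rw [hc2, h.meet]
  all_goals
    have himp : p.cost + multiplier st * p.weight < st.plus.cost + multiplier st * st.plus.weight :=
      lt_of_le_of_ne (h.le_plus hp) (not_or.1 hc2).1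
  · have hround : N.LogrRound st p ⟨al, U, st.plus, p⟩ :=
      ⟨hp, hp2 rfl, himp, h3, h4, Or.inr ⟨hc3, rfl, rfl⟩⟩
    exact ens_pure ⟨by unfold logrRoundTime; omega,
      Or.inl ⟨_, rfl, h.next hround h1 h2, p, hround⟩⟩
  · have hround : N.LogrRound st p ⟨al, U, p, st.minus⟩ :=
      ⟨hp, hp2 rfl, himp, h3, h4,
        Or.inl ⟨lt_of_le_of_ne (not_lt.1 hc3) (Ne.symm hpw), rfl, rfl⟩⟩
    exact ens_pure ⟨by unfold logrRoundTime; omega,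
      Or.inl ⟨_, rfl, h.next hround h1 h2, p, hround⟩⟩

/-! ### Walks as zero-one vectors -/

/-- The arcs of the network: its edges, each in both directions. -/
def arcs (N : Network V) : Finset (V × V) :=
  (N.verts.toFinset ×ˢ N.verts.toFinset).filter fun a => a.2 ∈ N.nbrs a.1

theorem mem_arcs {a : V × V} :
    a ∈ N.arcs ↔ (a.1 ∈ N.verts ∧ a.2 ∈ N.verts) ∧ a.2 ∈ N.nbrs a.1 := by
  simp only [arcs, Finset.mem_filter, Finset.mem_product, List.mem_toFinset]

/-- The number of times that a list of vertices runs through an arc. -/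
def arcCount (l : List V) (a : V × V) : ℕ := (l.zip l.tail).count a

theorem arcCount_le_one {l : List V} (hl : l.Nodup) (a : V × V) : arcCount l a ≤ 1 := by
  refine List.nodup_iff_count_le_one.1 (List.Nodup.of_map Prod.snd ?_) a
  rw [List.map_snd_zip (by simp)]
  exact hl.tail

theorem walkLen_eq_sum (hN : N.Regular) (len : V → V → ℝ) : ∀ l : List V,
    (l.IsChain fun a b => b ∈ N.nbrs a) → (∀ x ∈ l, x ∈ N.verts) →
    walkLen len l = ∑ a : N.arcs, len a.1.1 a.1.2 * arcCount l a.1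
  | [], _, _ => by simp [walkLen, arcCount]
  | [x], _, _ => by simp [walkLen, arcCount]
  | x :: y :: l, hc, hm => by
    have hxy : (x, y) ∈ N.arcs :=
      mem_arcs.2 ⟨⟨hm x (by simp), hm y (by simp)⟩, (List.isChain_cons_cons.1 hc).1⟩
    have ih := walkLen_eq_sum hN len (y :: l) (List.isChain_cons_cons.1 hc).2
      fun z hz => hm z (List.mem_cons_of_mem _ hz)
    have hcount : ∀ a : N.arcs, len a.1.1 a.1.2 * (arcCount (x :: y :: l) a.1 : ℝ) =
        (if a = ⟨(x, y), hxy⟩ then len a.1.1 a.1.2 else 0) +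
          len a.1.1 a.1.2 * arcCount (y :: l) a.1 := by
      intro a
      have : arcCount (x :: y :: l) a.1 = arcCount (y :: l) a.1 + if (x, y) == a.1 then 1 else 0 := by
        simp only [arcCount, List.tail_cons, List.zip_cons_cons, List.count_cons]
      rw [this]
      by_cases ha : a = ⟨(x, y), hxy⟩
      · subst ha
        simp
        ring
      · have ha' : ((x, y) == a.1) = false := by
          rw [beq_eq_false_iff_ne]
          exact fun he => ha (Subtype.ext he.symm)
        simp [ha, ha']
    rw [walkLen, ih, Finset.sum_congr rfl fun a _ => hcount a, Finset.sum_add_distrib,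
      Finset.sum_ite_eq' Finset.univ]
    simp

/-- The number of rounds of the second phase is `O(m ^ 2 log m)`, where `m` is the number of arcs. -/
theorem rounds_le (hN : N.Regular) {o : List V} {k : ℕ} {f : ℕ → LogrState V} {r : ℕ → Route V}
    (hf : ∀ i ≤ k, N.LogrInv o (f i)) (hr : ∀ i < k, N.LogrRound (f i) (r i) (f (i + 1))) :
    k ≤ 2 * newtonBound (N.arcs.card + 1) := by
  have hmono : ∀ i j, i ≤ j → j ≤ k → ∀ x, (f j).alive x = true → (f i).alive x = true := by
    intro i j hij
    induction j, hij using Nat.le_induction with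
    | base => exact fun _ _ h => h
    | succ j hij ih => exact fun hj x hx => ih (by omega) x ((hr j (by omega)).mono x hx)
  have hrounds : Rounds k N.budget (fun i => (f i).plus.cost) (fun i => (f i).plus.weight)
      (fun i => (f i).minus.cost) (fun i => (f i).minus.weight) (fun i => (r i).cost)
      (fun i => (r i).weight) fun i => multiplier (f i) := by
    refine ⟨fun i hi => (hf i hi).plus_weight.le, fun i hi => (hf i hi).minus_weight, fun i hi => ?_,
      fun i hi => ?_, fun i j hij hj => ?_, fun i hi => ?_⟩
    · have := (hf i hi).meet
      linarith
    · have := (hr i hi).improves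
      linarith
    · have h1 := (hr i (hij.trans_lt hj)).shortest
      have h2 := (hr j hj).shortest.route
      have h3 := h1.least _ (h2.walk.mono (hmono i j hij hj.le))
      rw [walkLen_lenAt, walkLen_lenAt, ← h1.route.cost, ← h1.route.weight, ← h2.cost,
        ← h2.weight] at h3
      linarith
    · rcases (hr i hi).step with ⟨h1, h2, h3⟩ | ⟨h1, h2, h3⟩
      · exact Or.inl ⟨h1, by rw [h2], by rw [h2], by rw [h3], by rw [h3]⟩
      · exact Or.inr ⟨h1, by rw [h2], by rw [h2], by rw [h3], by rw [h3]⟩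
  -- beyond the last round the vectors are irrelevant, and are taken to be zero
  let y : ℕ → N.arcs → ℕ := fun i a => if i < k then arcCount (r i).verts a.1 else 0
  have hy : ∀ i a, y i a ≤ 1 := by
    intro i a
    simp only [y]
    split_ifs with hi
    · exact arcCount_le_one (hr i hi).nodup _
    · exact Nat.zero_le 1
  have hlin : ∀ len : V → V → ℝ, ∀ i < k,
      walkLen len (r i).verts = ∑ a : N.arcs, len a.1.1 a.1.2 * y i a := by
    intro len i hi
    have hw := (hr i hi).shortest.route.walk
    simp only [y, if_pos hi]
    exact walkLen_eq_sum hN len _ hw.chain (hw.mem_verts hN hN.src_mem)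
  have := hrounds.length_le (ι := N.arcs) (u := fun a => N.cost a.1.1 a.1.2)
    (w := fun a => N.weight a.1.1 a.1.2) hy
    (fun i hi => (hr i hi).shortest.route.cost.trans (hlin _ i hi))
    (fun i hi => (hr i hi).shortest.route.weight.trans (hlin _ i hi))
  rwa [Fintype.card_coe] at this

/-- A bound for the time of the second phase on `n` vertices and `m` arcs. -/
def logrTime (n m : ℕ) : ℕ := (2 * newtonBound (m + 1) + 1) * (logrRoundTime n + 1)

theorem ens_logr (hN : N.Regular) {o : List V} {st : LogrState V} (h : N.LogrInv o st) :
    (N.logr st).Ens fun out n => N.Correct out ∧ n ≤ logrTime N.verts.length N.arcs.card := by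
  unfold logr
  set T := logrRoundTime N.verts.length + 1 with hT
  set b := 2 * newtonBound (N.arcs.card + 1) with hb
  -- the ghost value is the number of rounds, with the states and the routes of these rounds
  let Inv : ℕ × (ℕ → LogrState V) × (ℕ → Route V) → LogrState V → Prop := fun g s =>
    g.2.1 g.1 = s ∧ (∀ i ≤ g.1, N.LogrInv o (g.2.1 i)) ∧
      ∀ i < g.1, N.LogrRound (g.2.1 i) (g.2.2 i) (g.2.1 (i + 1))
  refine (ens_loop Inv (fun g _ => (b + 1 - g.1) * T) N.Correct ?_
    (g := (0, fun _ => st, fun _ => st.best))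
    ⟨rfl, fun _ _ => h, fun i hi => absurd hi (Nat.not_lt_zero i)⟩).mono
    fun out n hn => ⟨hn.1, hn.2⟩
  rintro ⟨k, f, r⟩ s ⟨hfk, hf, hr⟩
  dsimp only at hfk hf hr
  subst hfk
  refine (ens_logrStep hN (hf k le_rfl)).mono ?_
  rintro res n ⟨hn, ⟨s', rfl, hs', p, hp⟩ | ⟨out, rfl, hout⟩⟩
  · set f' : ℕ → LogrState V := Function.update f (k + 1) s' with hf'
    set r' : ℕ → Route V := Function.update r k p with hr'
    have hfold : ∀ i ≤ k, f' i = f i := fun i hi => Function.update_of_ne (by omega) _ _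
    have hrold : ∀ i < k, r' i = r i := fun i hi => Function.update_of_ne (by omega) _ _
    have hfnew : f' (k + 1) = s' := Function.update_self _ _ _
    have hrnew : r' k = p := Function.update_self _ _ _
    have hInv1 : ∀ i ≤ k + 1, N.LogrInv o (f' i) := by
      intro i hi
      rcases hi.lt_or_eq with hi | rfl
      · rw [hfold i (by omega)]
        exact hf i (by omega)
      · rwa [hfnew]
    have hInv2 : ∀ i < k + 1, N.LogrRound (f' i) (r' i) (f' (i + 1)) := by
      intro i hi
      rcases (Nat.lt_succ_iff.1 hi).lt_or_eq with hi | rfl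
      · rw [hfold i hi.le, hfold (i + 1) hi, hrold i hi]
        exact hr i hi
      · rwa [hfold i le_rfl, hfnew, hrnew]
    have hk := rounds_le hN hInv1 hInv2
    refine Or.inl ⟨s', rfl, (k + 1, f', r'), ⟨hfnew, hInv1, hInv2⟩, ?_⟩
    have e : b + 1 - k = (b + 1 - (k + 1)) + 1 := by omega
    have e2 : (b + 1 - k) * T = (b + 1 - (k + 1)) * T + T := by rw [e, Nat.add_mul, Nat.one_mul]
    change n + 1 + (b + 1 - (k + 1)) * T ≤ (b + 1 - k) * T
    omega
  · have hk := rounds_le hN hf hr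
    refine Or.inr ⟨out, rfl, hout, ?_⟩
    have := Nat.mul_le_mul_right T (show 1 ≤ b + 1 - k by omega)
    change n + 1 ≤ (b + 1 - k) * T
    omega

/-- A linked vertex other than the source lies on an edge. -/
theorem scansLeft_le (hN : N.Regular)
    (alive : V → Bool) : N.scansLeft alive ≤ N.arcs.card + 3 := by
  classical
  have hsub : (N.verts.toFinset.filter fun v => alive v = true ∧ N.Linked v) ⊆
      insert N.src (N.arcs.image Prod.fst) := by
    intro v hv
    obtain ⟨hv1, -, l, hl, hvl⟩ := Finset.mem_filter.1 hv
    obtain ⟨a, b, rfl⟩ := List.append_of_mem hvl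
    have hreach := hl.split_left.reach (len := N.cost)
    generalize walkLen N.cost (a ++ [v]) = k at hreach
    cases hreach with
    | refl => exact Finset.mem_insert_self _ _
    | @snoc u _ k hu hadj _ =>
      have hadj' := hN.nbrs_symm _ _ hadj
      refine Finset.mem_insert_of_mem (Finset.mem_image.2 ⟨(v, u), ?_, rfl⟩)
      exact mem_arcs.2 ⟨⟨List.mem_toFinset.1 hv1, hN.nbrs_mem _ _ hadj'⟩, hadj'⟩
  have h1 := (Finset.card_le_card hsub).trans (Finset.card_insert_le _ _)
  have h2 : (N.arcs.image Prod.fst).card ≤ N.arcs.card := Finset.card_image_le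
  unfold scansLeft
  split_ifs <;> omega

/-! ### Correctness and time of the whole algorithm -/

/-- A bound for the time of the algorithm on `n` vertices and `m` arcs, if the first phase makes at most
`s` scans. -/
def cologrTime (n m s : ℕ) : ℕ :=
  4 * routeTime n + s * (cogrScanTime n + 1) + logrTime n m + eraseTime n

theorem BestRoute.shortestAt {K : Type} [AddCommMonoid K] [LinearOrder K] {alive : V → Bool}
    {len : V → V → K} {q : Route V} (h : N.BestRoute alive len N.src (some q)) :
    N.IsRoute alive q ∧ ∀ l, N.IsWalk alive N.src N.dst l → walkLen len q.verts ≤ walkLen len l :=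
  ⟨h.1, fun l hl => h.2.2.2 l hl hl.src_mem⟩

theorem ens_cologr (hN : N.Regular) : N.cologr.Ens fun out n => N.Correct out ∧
    n ≤ cologrTime N.verts.length N.arcs.card (N.scansLeft (full V)) := by
  unfold cologr
  refine ens_bind ((ens_routeThrough (alive := full V) hN (lenInf_pos hN) (lenInf_symm hN) rfl
    hN.src_mem).mono ?_)
  rintro rInf n1 ⟨hn1, hInf⟩
  refine ens_bind ((ens_routeThrough (alive := full V) hN hN.cost_pos hN.cost_symm rfl
    hN.src_mem).mono ?_)
  rintro rZero n2 ⟨hn2, hZero⟩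
  rcases rInf with _ | a
  · refine ens_pure ⟨fun l hl => absurd hl.src_mem (hInf l hl), by unfold cologrTime; omega⟩
  rcases rZero with _ | b
  · refine ens_pure ⟨fun l hl => absurd hl.src_mem (hZero l hl), by unfold cologrTime; omega⟩
  obtain ⟨ha1, ha2⟩ := hInf.shortestAt
  obtain ⟨hb1, hb2⟩ := hZero.shortestAt
  simp only
  split_ifs with hbw haw
  · refine ens_bind ((ens_eraseLoops_route hN hb1).mono ?_)
    rintro l n ⟨hn, h1, h2, h3, h4⟩
    refine ens_pure ⟨⟨h1, h2, h4.trans hbw, fun k hk _ => h3.trans ?_⟩, by unfold cologrTime; omega⟩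
    rw [hb1.cost]
    exact hb2 k hk
  · refine ens_pure ⟨fun l hl hlw => ?_, by unfold cologrTime; omega⟩
    have := weight_le_of_lenInf_le (ha2 l hl)
    rw [← ha1.weight] at this
    exact absurd (this.trans hlw) haw.not_ge
  rw [not_lt] at haw
  have ha : N.Incumbent a := ⟨ha1, haw⟩
  obtain ⟨o, ho⟩ := exists_keepsOptimal hN ha1.walk (ha1.weight ▸ haw)
  refine ens_bind ((ens_cogr hN ho ha).mono ?_)
  rintro ⟨al, U⟩ n3 ⟨⟨hal, hU⟩, hn3⟩
  dsimp only at hal hU ⊢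
  have hsrc : al N.src = true := hal.walk.present _ hal.walk.src_mem
  refine ens_bind ((ens_routeThrough hN (lenInf_pos hN) (lenInf_symm hN) hsrc hN.src_mem).mono ?_)
  rintro rInf n4 ⟨hn4, hInf'⟩
  refine ens_bind ((ens_routeThrough hN hN.cost_pos hN.cost_symm hsrc hN.src_mem).mono ?_)
  rintro rZero n5 ⟨hn5, hZero'⟩
  rcases rInf with _ | a'
  · exact absurd hal.walk.src_mem (hInf' o hal.walk)
  rcases rZero with _ | b'
  · exact absurd hal.walk.src_mem (hZero' o hal.walk)
  obtain ⟨ha1', ha2'⟩ := hInf'.shortestAt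
  obtain ⟨hb1', hb2'⟩ := hZero'.shortestAt
  have hb3 := hb2' o hal.walk
  rw [← hb1'.cost] at hb3
  simp only
  split_ifs with hbw'
  · refine ens_bind ((ens_eraseLoops_optimal hN hal hb1'.to_full hbw' hb3).mono ?_)
    rintro l n ⟨hn, hl⟩
    exact ens_pure ⟨hl, by unfold cologrTime; omega⟩
  · have hw := weight_le_of_lenInf_le (ha2' o hal.walk)
    have hc := hb2' _ ha1'.walk
    rw [← hb1'.cost, ← ha1'.cost] at hc
    rw [← ha1'.weight] at hw
    refine (ens_logr hN (o := o) ⟨hal, hU, hb1'.to_full, not_le.1 hbw', ha1'.to_full,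
      hw.trans hal.feasible, hc, ⟨0, le_rfl, fun l hl => ?_⟩, Or.inl hb1'.walk⟩).mono ?_
    · have := hb2' l hl
      rw [← hb1'.cost] at this
      simpa using this
    · rintro out n ⟨h1, h2⟩
      exact ⟨h1, by unfold cologrTime; omega⟩

end Network

/-! ### Grid graphs -/

namespace RCDPInstance

variable (I : RCDPInstance)

theorem mem_nbrs {u v : ℤ × ℤ} : v ∈ I.toNetwork.nbrs u ↔ I.graph.Adj u v := by
  simp only [toNetwork, List.mem_filter, List.mem_map, decide_eq_true_eq]
  refine ⟨fun h => h.2, fun h => ⟨⟨v - u, ?_, by simp⟩, h⟩⟩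
  obtain ⟨hne, h1, h2⟩ := I.adj_lattice u v h
  rw [abs_le] at h1 h2
  obtain ⟨a, b⟩ := u
  obtain ⟨c, d⟩ := v
  dsimp only at h1 h2
  have hne' : c - a ≠ 0 ∨ d - b ≠ 0 := by
    by_contra! hcon
    exact hne (Prod.ext (by dsimp only; omega) (by dsimp only; omega))
  have h3 : c - a = -1 ∨ c - a = 0 ∨ c - a = 1 := by omega
  have h4 : d - b = -1 ∨ d - b = 0 ∨ d - b = 1 := by omega
  simp only [Prod.mk_sub_mk]
  rcases h3 with h3 | h3 | h3 <;> rcases h4 with h4 | h4 | h4 <;> simp [h3, h4] at hne' ⊢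

theorem planePoint_injective : Function.Injective planePoint := by
  intro u v h
  have h0 := congrArg (fun x : EuclideanSpace ℝ (Fin 2) => x 0) h
  have h1 := congrArg (fun x : EuclideanSpace ℝ (Fin 2) => x 1) h
  simp only [planePoint] at h0 h1
  exact Prod.ext (by simpa using h0) (by simpa using h1)

theorem obstaclesAt_symm (u v : ℤ × ℤ) : I.obstaclesAt u v = I.obstaclesAt v u := by
  unfold obstaclesAt
  rw [segment_symm]

theorem mem_obstacles {u v : ℤ × ℤ} {x : Obstacle} (h : x ∈ I.obstaclesAt u v) :
    x ∈ I.obstacles := by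
  classical
  exact Finset.filter_subset _ _ h

theorem regular_toNetwork : I.toNetwork.Regular where
  nbrs_symm u v h := I.mem_nbrs.2 (I.mem_nbrs.1 h).symm
  nbrs_mem u v h := (I.adj_mem u v (I.mem_nbrs.1 h)).2
  length_nbrs_le u := (List.length_filter_le _ _).trans (by simp)
  cost_symm u v := by
    change I.edgeCost u v = I.edgeCost v u
    unfold edgeCost
    rw [dist_comm, obstaclesAt_symm]
  weight_symm u v := by
    change I.edgeWeight u v = I.edgeWeight v u
    unfold edgeWeight
    rw [obstaclesAt_symm]
  cost_pos u v h := by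
    have h1 : 0 < dist (planePoint u) (planePoint v) :=
      dist_pos.2 fun he => (I.mem_nbrs.1 h).ne (planePoint_injective he)
    have h2 : 0 ≤ ∑ x ∈ I.obstaclesAt u v, I.risk x :=
      Finset.sum_nonneg fun x hx => I.risk_nonneg x (I.mem_obstacles hx)
    change 0 < I.edgeCost u v
    unfold edgeCost
    linarith
  weight_nonneg u v := by
    have h2 : 0 ≤ ∑ x ∈ I.obstaclesAt u v, x.disambCost :=
      Finset.sum_nonneg fun x hx => (I.disambCost_pos x (I.mem_obstacles hx)).le
    change 0 ≤ I.edgeWeight u v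
    unfold edgeWeight
    linarith
  src_mem := I.source_mem

variable {I}

theorem sum_darts_eq_walkLen (len : ℤ × ℤ → ℤ × ℤ → ℝ) {u v : ℤ × ℤ} (p : I.graph.Walk u v) :
    (p.darts.map fun d => len d.fst d.snd).sum = Network.walkLen len p.support := by
  induction p with
  | nil => simp [Network.walkLen]
  | cons h p ih =>
    rw [SimpleGraph.Walk.darts_cons, List.map_cons, List.sum_cons, ih,
      SimpleGraph.Walk.support_cons, ← p.cons_tail_support, Network.walkLen]

theorem isWalk_support {u v : ℤ × ℤ} (p : I.graph.Walk u v) :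
    I.toNetwork.IsWalk (Network.full _) u v p.support := by
  refine ⟨?_, ?_, fun _ _ => rfl, ?_⟩
  · rw [← p.cons_tail_support, List.head?_cons]
  · rw [List.getLast?_eq_getLast_of_ne_nil p.support_ne_nil, p.getLast_support]
  · exact p.isChain_adj_support.imp fun a b h => I.mem_nbrs.2 h

theorem exists_walk {v : ℤ × ℤ} : ∀ (l : List (ℤ × ℤ)) (u : ℤ × ℤ),
    I.toNetwork.IsWalk (Network.full _) u v l → ∃ p : I.graph.Walk u v, p.support = l
  | [], u, h => by cases h.head
  | [x], u, h => by
    cases h.head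
    cases h.last
    exact ⟨SimpleGraph.Walk.nil, rfl⟩
  | x :: y :: l, u, h => by
    cases h.head
    obtain ⟨p, hp⟩ := exists_walk (y :: l) y (h.split_right (a := [x]))
    have hadj := I.mem_nbrs.1 (List.isChain_cons_cons.1 h.chain).1
    exact ⟨SimpleGraph.Walk.cons hadj p, by rw [SimpleGraph.Walk.support_cons, hp]⟩

theorem pathCost_eq {u v : ℤ × ℤ} (p : I.graph.Walk u v) :
    I.pathCost p = Network.walkLen I.toNetwork.cost p.support :=
  sum_darts_eq_walkLen _ p

theorem pathWeight_eq {u v : ℤ × ℤ} (p : I.graph.Walk u v) :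
    I.pathWeight p = Network.walkLen I.toNetwork.weight p.support :=
  sum_darts_eq_walkLen _ p

theorem solves_of_correct {out : Outcome (ℤ × ℤ)} (h : I.toNetwork.Correct out) :
    I.Solves out := by
  have hfeas : ∀ q : I.graph.Walk I.source I.target, I.Feasible q →
      Network.walkLen I.toNetwork.weight q.support ≤ I.toNetwork.budget := fun q hq =>
    pathWeight_eq q ▸ hq.2
  cases out with
  | infeasible => exact fun q hq => h _ (isWalk_support q) (hfeas q hq)
  | optimal path =>
    obtain ⟨h1, h2, h3, h4⟩ := h
    obtain ⟨p, rfl⟩ := exists_walk (I := I) (v := I.target) path I.source h2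
    refine ⟨p, rfl, ⟨(SimpleGraph.Walk.isPath_def p).2 h1, (pathWeight_eq p).trans_le h3⟩, ?_⟩
    intro q hq
    rw [pathCost_eq, pathCost_eq]
    exact h4 _ (isWalk_support q) (hfeas q hq)
  | bestFeasible path lower =>
    obtain ⟨h1, h2, h3, h4, h5⟩ := h
    obtain ⟨p, rfl⟩ := exists_walk (I := I) (v := I.target) path I.source h2
    refine ⟨p, rfl, ⟨(SimpleGraph.Walk.isPath_def p).2 h1, (pathWeight_eq p).trans_le h3⟩, ?_, ?_⟩
    · intro q hq
      rw [pathCost_eq]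
      exact h4 _ (isWalk_support q) (hfeas q hq)
    · intro μ hμ
      obtain ⟨k, hk1, hk2, hk3⟩ := h5 μ hμ
      obtain ⟨q, rfl⟩ := exists_walk (I := I) (v := I.target) k I.source hk2
      refine ⟨q, (SimpleGraph.Walk.isPath_def q).2 hk1, ?_⟩
      rw [pathCost_eq, pathWeight_eq]
      exact hk3

variable (I)

theorem finite_edgeSet : I.graph.edgeSet.Finite := by
  refine ((I.verts.toFinset ×ˢ I.verts.toFinset).finite_toSet.image fun a => s(a.1, a.2)).subset ?_
  intro e
  induction e with
  | _ u v =>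
    intro he
    have := I.adj_mem u v ((SimpleGraph.mem_edgeSet _).1 he)
    exact ⟨(u, v), by simpa using this, rfl⟩

theorem card_arcs_le : I.toNetwork.arcs.card ≤ 2 * I.numEdges := by
  have h1 := Finset.card_le_mul_card_image (f := fun a : (ℤ × ℤ) × (ℤ × ℤ) => s(a.1, a.2))
    I.toNetwork.arcs 2 (by
      intro e _
      induction e with
      | _ u v =>
        refine (Finset.card_le_card (t := {(u, v), (v, u)}) ?_).trans Finset.card_le_two
        rintro ⟨a, b⟩ hab
        have := (Finset.mem_filter.1 hab).2
        simp only [Sym2.eq_iff] at this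
        simp only [Finset.mem_insert, Finset.mem_singleton, Prod.mk.injEq]
        exact this)
  refine h1.trans (Nat.mul_le_mul_left 2 ?_)
  rw [← Set.ncard_coe_finset]
  refine Set.ncard_le_ncard ?_ I.finite_edgeSet
  intro e he
  obtain ⟨a, ha, rfl⟩ := Finset.mem_image.1 (Finset.mem_coe.1 he)
  exact I.mem_nbrs.1 (Network.mem_arcs.1 ha).2

end RCDPInstance

/-! ### The time bound -/

theorem natLog_two_le {k n e : ℕ} (h : k ≤ n ^ e) :
    (Nat.log 2 k : ℝ) ≤ e * (3 / 2 * Real.log n) := by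
  have hl2 := Real.log_two_gt_d9
  rcases Nat.eq_zero_or_pos k with rfl | hk
  · simp only [Nat.log_zero_right, Nat.cast_zero]
    have : 0 ≤ Real.log n := Real.log_natCast_nonneg n
    positivity
  have h1 : 2 ^ Nat.log 2 k ≤ n ^ e := (Nat.pow_log_le_self 2 hk.ne').trans h
  have h2 : ((2 : ℝ) ^ Nat.log 2 k) ≤ (n : ℝ) ^ e := by exact_mod_cast h1
  have h3 := Real.log_le_log (by positivity) h2
  rw [Real.log_pow, Real.log_pow] at h3
  have h4 : (Nat.log 2 k : ℝ) * (2 / 3) ≤ Nat.log 2 k * Real.log 2 :=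
    mul_le_mul_of_nonneg_left (by linarith) (Nat.cast_nonneg _)
  linarith

theorem newtonBound_mono {p q : ℕ} (h : p ≤ q) : newtonBound p ≤ newtonBound q := by
  unfold newtonBound
  have := Nat.log_mono_right (b := 2) h
  gcongr

theorem newtonBound_le {m : ℕ} (hm : 2 ≤ m) :
    (newtonBound (2 * m + 1) : ℝ) ≤ 2000 * ((m : ℝ) ^ 2 * Real.log m) := by
  have hl2 := Real.log_two_gt_d9
  have hmR : (2 : ℝ) ≤ m := by exact_mod_cast hm
  have hL : Real.log 2 ≤ Real.log m := Real.log_le_log (by norm_num) hmR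
  have h1 : (Nat.log 2 (2 * m + 1) : ℝ) ≤ (3 : ℕ) * (3 / 2 * Real.log m) :=
    natLog_two_le (by nlinarith [Nat.mul_le_mul hm hm])
  push_cast at h1
  have h2 : (Nat.log 2 (2 * m + 1) : ℝ) + 2 ≤ 8 * Real.log m := by linarith
  unfold newtonBound
  push_cast
  calc 4 * (2 * (m : ℝ) + 1) * ((Nat.log 2 (2 * m + 1) : ℝ) + 2) * (8 * (2 * m + 1) + 6)
      ≤ (10 * m) * (8 * Real.log m) * (23 * m) := by
        have h3 : 0 ≤ Real.log m := by linarith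
        refine mul_le_mul (mul_le_mul (by linarith) h2 (by positivity) (by positivity)) (by linarith)
          (by positivity) (by positivity)
    _ = 1840 * ((m : ℝ) ^ 2 * Real.log m) := by ring
    _ ≤ _ := by
        have : 0 ≤ (m : ℝ) ^ 2 * Real.log m := by
          have : 0 ≤ Real.log m := by linarith
          positivity
        linarith

theorem routeTime_le {n : ℕ} (hn : 2 ≤ n) :
    (Network.routeTime n : ℝ) ≤ 400 * (n * Real.log n) := by
  have hl2 := Real.log_two_gt_d9
  have hnR : (2 : ℝ) ≤ n := by exact_mod_cast hn
  have hL : Real.log 2 ≤ Real.log n := Real.log_le_log (by norm_num) hnR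
  have h1 : (Network.rankBound n : ℝ) ≤ (5 : ℕ) * (3 / 2 * Real.log n) := by
    refine natLog_two_le ?_
    have h2 : 2 ^ 4 ≤ n ^ 4 := Nat.pow_le_pow_left hn 4
    have h3 : n ^ 5 = n ^ 4 * n := by ring
    nlinarith
  push_cast at h1
  unfold Network.routeTime Network.dijkstraTime
  push_cast
  set R : ℝ := (Network.rankBound n : ℝ)
  have hR : 0 ≤ R := Nat.cast_nonneg _
  have h2 : R ≤ n * R := le_mul_of_one_le_left hR (by linarith)
  have h3 : (n : ℝ) * (26 * R + 53) ≤ n * (400 * Real.log n) := by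
    refine mul_le_mul_of_nonneg_left ?_ (by linarith)
    linarith
  nlinarith

/-- The dominant part of the time are the `O(m ^ 2 log m)` rounds of the second phase, with `n` shortest
path computations each, on `n` vertices and `m` edges. -/
theorem cologrTime_le {n m a s : ℕ} (hn : 2 ≤ n) (hm : 2 ≤ m) (ha : a ≤ 2 * m) (hs : s ≤ 2 * m + 3) :
    (Network.cologrTime n a s : ℝ) ≤
      5000000 * (n * (m : ℝ) ^ 2 * Real.log m * (m + n * Real.log n)) := by
  have hl2 := Real.log_two_gt_d9
  have hnR : (2 : ℝ) ≤ n := by exact_mod_cast hn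
  have hmR : (2 : ℝ) ≤ m := by exact_mod_cast hm
  have hLn : Real.log 2 ≤ Real.log n := Real.log_le_log (by norm_num) hnR
  have hLm : Real.log 2 ≤ Real.log m := Real.log_le_log (by norm_num) hmR
  have hrt := routeTime_le hn
  have hnb : (newtonBound (a + 1) : ℝ) ≤ 2000 * ((m : ℝ) ^ 2 * Real.log m) :=
    le_trans (by exact_mod_cast newtonBound_mono (by omega)) (newtonBound_le hm)
  have hsR : (s : ℝ) ≤ 2 * m + 3 := by exact_mod_cast hs
  set x : ℝ := n * Real.log n with hx
  set y : ℝ := (m : ℝ) ^ 2 * Real.log m with hy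
  set r : ℝ := (Network.routeTime n : ℝ) with hr
  have hnx : (n : ℝ) ≤ 2 * x := by rw [hx]; nlinarith
  have hx1 : 1 ≤ x := by linarith
  have hmy : (m : ℝ) ≤ y := by
    have : 1 ≤ m * Real.log m := by nlinarith
    rw [hy]
    nlinarith
  have hr0 : 0 ≤ r := Nat.cast_nonneg _
  set z : ℝ := n * x with hz
  have hxz : 2 * x ≤ z := mul_le_mul_of_nonneg_right hnR (by linarith)
  have hnz : (n : ℝ) * n ≤ 2 * z := by
    have := mul_le_mul_of_nonneg_left hnx (show (0 : ℝ) ≤ n by linarith)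
    linarith
  have hnr : (n : ℝ) * r ≤ 400 * z := by
    have := mul_le_mul_of_nonneg_left hrt (show (0 : ℝ) ≤ n by linarith)
    linarith
  have herase : (Network.eraseTime n : ℝ) ≤ 24 * z := by
    unfold Network.eraseTime
    push_cast
    nlinarith
  have hcogr : (Network.cogrScanTime n : ℝ) + 1 ≤ 802 * z := by
    unfold Network.cogrScanTime
    push_cast
    rw [← hr]
    linarith
  have hround : (Network.logrRoundTime n : ℝ) + 1 ≤ 702 * z := by
    unfold Network.logrRoundTime Network.logrScanTime
    push_cast
    rw [← hr]
    linarith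
  have hlogr : (Network.logrTime n a : ℝ) ≤ (4001 * y) * (702 * z) := by
    unfold Network.logrTime
    push_cast
    refine mul_le_mul (by linarith) hround (by positivity) (by linarith)
  have hphase1 : (s : ℝ) * ((Network.cogrScanTime n : ℝ) + 1) ≤ (5 * y) * (802 * z) :=
    mul_le_mul (by linarith) hcogr (by positivity) (by linarith)
  have hzy : z ≤ y * z := le_mul_of_one_le_left (by linarith) (by linarith)
  have hfinal : y * z ≤ n * (m : ℝ) ^ 2 * Real.log m * (m + n * Real.log n) := by
    have h1 : y * z = n * y * x := by rw [hz]; ring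
    have h2 : n * (m : ℝ) ^ 2 * Real.log m * (m + n * Real.log n) = n * y * (m + x) := by
      rw [hx, hy]; ring
    rw [h1, h2]
    have h3 : 0 ≤ (n : ℝ) * y := mul_nonneg (by linarith) (by linarith)
    exact mul_le_mul_of_nonneg_left (by linarith) h3
  unfold Network.cologrTime
  push_cast
  rw [← hr]
  linarith

theorem mainTheorem1 :
    ∃ C : ℝ, 0 < C ∧ ∀ I : RCDPInstance,
      ∃ (out : Outcome (ℤ × ℤ)) (steps : ℕ),
        I.toNetwork.cologr.RunsTo out steps ∧ I.Solves out ∧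
          (2 ≤ I.numEdges →
            (steps : ℝ) ≤ C *
              ((I.numVerts : ℝ) * (I.numEdges : ℝ) ^ 2 * Real.log (I.numEdges : ℝ) *
                ((I.numEdges : ℝ) + (I.numVerts : ℝ) * Real.log (I.numVerts : ℝ)))) := by
  refine ⟨5000000, by norm_num, fun I => ?_⟩
  have hN := I.regular_toNetwork
  obtain ⟨out, steps, hrun, hcorrect, hsteps⟩ := Network.ens_cologr hN
  refine ⟨out, steps, hrun, RCDPInstance.solves_of_correct hcorrect, fun hm => ?_⟩
  have hn : 2 ≤ I.numVerts := by
    obtain ⟨e, he⟩ : I.graph.edgeSet.Nonempty :=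
      Set.nonempty_of_ncard_ne_zero (by unfold RCDPInstance.numEdges at hm; omega)
    induction e with
    | _ u v =>
      have hadj := (SimpleGraph.mem_edgeSet _).1 he
      have hmem := I.adj_mem u v hadj
      have h2 : [u, v].Nodup := by simpa using hadj.ne
      exact (List.subperm_of_subset h2 (by simpa using hmem)).length_le
  have harcs := I.card_arcs_le
  have hscans := Network.scansLeft_le hN (Network.full (ℤ × ℤ))
  refine le_trans ?_ (cologrTime_le hn hm harcs (hscans.trans (by omega)))
  exact_mod_cast hsteps
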